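/- Let $(\overline M,\overline g)$ be a connected smooth semi-Riemannian manifold of dimension $n+1$ with Levi-Civita connection $\overline\nabla$, and let $x:M\to\overline M$ be a smooth embedding of a connected smooth $n$-dimensional manifold such that $g=x^\star\overline g$ is degenerate at every point (a null hypersurface). Let $N$ be a null rigging for $M$: a smooth vector field, defined on an open subset of $\overline M$ containing $M$, which at every point of $M$ is lightlike and not tangent to $M$. Put $\eta=x^\star\overline g(N,\cdot)$, and let $\xi$ be the unique vector field on $M$ with $g(\xi,\cdot)=0$ and $\overline g(\xi,N)=1$. Let $\mathcal S=\ker\eta$ be the screen distribution; thus $T\overline M|_M=TM\oplus\mathrm{span}(N)$ and $TM=\mathcal S\oplus\mathrm{span}(\xi)$. The induced connection $\nabla$ on $M$, the rotation $1$-form $\tau$ and the shape operators $A_N$, $\stackrel{\star}{A}_\xi$ are defined, for vector fields $X,Y$ tangent to $M$, by $$\overline\nabla_XY=\nabla_XY+B(X,Y)N,\qquad \overline\nabla_XN=-A_NX+\tau(X)N,\qquad \nabla_X\xi=-\stackrel{\star}{A}_\xi X-\tau(X)\xi,$$ where $\nabla_XY$ and $A_NX$ are tangent to $M$ and $\stackrel{\star}{A}_\xi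 X\in\mathcal S$. For a nowhere vanishing smooth function $\alpha$ on $M$, the $\alpha$-associated metric is $g_\alpha=g+\alpha\,\eta\otimes\eta$; it is a semi-Riemannian metric on $M$. Assume that $(M,g,N)$ is closed, i.e. $d\eta=0$ (so that $\mathcal S$ is integrable). (i) Let $\alpha$ be a nowhere vanishing smooth function on $M$ which is constant on each leaf of the screen distribution. Then $\nabla$ is the Levi-Civita connection of $g_\alpha$ if and only if $$\stackrel{\star}{A}_\xi=\alpha A_N\quad\text{and}\quad 2\alpha\,\tau(\xi)+d\alpha(\xi)=0 .$$ (ii) Let $\alpha$ be a nonzero real number. Then $\nabla$ is the Levi-Civita connection of $g_\alpha$ if and only if $$\stackrel{\star}{A}_\xi=\alpha A_N\quad\text{and}\quad \tau\equiv0 .$$ -/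

import Mathlib

open Set Bundle Topology Manifold
open scoped Manifold ContDiff

noncomputable section

namespace NullHyp

/-! ### Semi-Riemannian metrics, Levi-Civita connections, connections along a map -/

section General

variable {E : Type*} [NormedAddCommGroup E] [NormedSpace ℝ E]
  {H : Type*} [TopologicalSpace H] (I : ModelWithCorners ℝ E H)
  (M : Type*) [TopologicalSpace M] [ChartedSpace H M]

/-- A smooth semi-Riemannian metric: a smooth field of nondegenerate symmetric bilinear forms on
the tangent spaces. (On a connected manifold its index is automatically constant.) -/
structure SemiRiemannianMetric [IsManifold I ∞ M] where
  /-- the bilinear form on each tangent space -/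
  val : ∀ q : M, TangentSpace I q →L[ℝ] TangentSpace I q →L[ℝ] ℝ
  symm : ∀ (q : M) (u v : TangentSpace I q), val q u v = val q v u
  nondegenerate : ∀ (q : M) (u : TangentSpace I q), (∀ v, val q u v = 0) → u = 0
  contMDiff : ContMDiff I (I.prod 𝓘(ℝ, E →L[ℝ] E →L[ℝ] ℝ)) ∞
    (fun q ↦ TotalSpace.mk' (E →L[ℝ] E →L[ℝ] ℝ)
      (E := fun q : M ↦ TangentSpace I q →L[ℝ] TangentSpace I q →L[ℝ] ℝ) q (val q))

variable {I M}

/-- `cov` is the Levi-Civita connection of the field `g` of bilinear forms on the tangent spaces: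
it is torsion-free and `v (g(Y, Z)) = g(∇_v Y, Z) + g(Y, ∇_v Z)`.
(`cov Y p v` is `∇_v Y` at the point `p`.) -/
structure IsLeviCivita [IsManifold I ∞ M] [FiniteDimensional ℝ E] [CompleteSpace E]
    (g : ∀ p : M, TangentSpace I p → TangentSpace I p → ℝ)
    (cov : CovariantDerivative I E (TangentSpace I : M → Type _)) : Prop where
  torsion_free : cov.torsion = 0
  metric : ∀ (p : M) (Y Z : ∀ p : M, TangentSpace I p), MDiffAt (T% Y) p → MDiffAt (T% Z) p →
    ∀ v : TangentSpace I p,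
      mvfderiv I (fun y ↦ g y (Y y) (Z y)) p v = g p (cov Y p v) (Z p) + g p (Y p) (cov Z p v)

/-- A 1-form `η` is closed: `dη(X, Y) = X(η(Y)) - Y(η(X)) - η([X, Y]) = 0`. -/
def IsClosedForm [IsManifold I ∞ M] (η : ∀ p : M, TangentSpace I p →L[ℝ] ℝ) : Prop :=
  ∀ (p : M) (X Y : ∀ p : M, TangentSpace I p), MDiffAt (T% X) p → MDiffAt (T% Y) p →
    mvfderiv I (fun y ↦ η y (Y y)) p (X p) - mvfderiv I (fun y ↦ η y (X y)) p (Y p)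
      - η p (VectorField.mlieBracket I X Y p) = 0

/-- The leaf through `p` of a distribution `D` of tangent subspaces: the set of all points that
can be joined to `p` by a piecewise `C¹` curve tangent to `D`. If `D` is integrable, this is the
maximal connected integral manifold of `D` through `p`. -/
def leaf (D : ∀ p : M, Submodule ℝ (TangentSpace I p)) (p : M) : Set M :=
  {q | Relation.ReflTransGen (fun a b ↦ ∃ γ : ℝ → M, ContMDiff 𝓘(ℝ, ℝ) I 1 γ ∧ γ 0 = a ∧ γ 1 = b ∧
    ∀ t ∈ Icc (0 : ℝ) 1, mfderiv 𝓘(ℝ, ℝ) I γ t (1 : ℝ) ∈ D (γ t)) p q}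

variable {E' : Type*} [NormedAddCommGroup E'] [NormedSpace ℝ E']
  {H' : Type*} [TopologicalSpace H'] {I' : ModelWithCorners ℝ E' H'}
  {M' : Type*} [TopologicalSpace M'] [ChartedSpace H' M'] [IsManifold I' ∞ M']

/-- The coordinates, in the trivialization of `TM'` given by the chart at `x p`, of a vector field
`V` along a map `x : M → M'`. -/
def coordsAlong (x : M → M') (V : ∀ p : M, TangentSpace I' (x p)) (p : M) (y : M) : E' :=
  (trivializationAt E' (TangentSpace I' : M' → Type _) (x p)).continuousLinearMapAt ℝ (x y) (V y)

/-- The vector field near `q` whose coordinates in the trivialization of `TM'` given by the chart at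
`q` are constant, equal to `w`. -/
def constField (q : M') (w : E') (y : M') : TangentSpace I' y :=
  (trivializationAt E' (TangentSpace I' : M' → Type _) q).symmL ℝ y w

/-- The covariant derivative of vector fields along a map `x : M → M'`, induced by a connection
`cov` of `M'`. If `(∂ᵢ)` is the frame of `TM'` given by the chart at `x p`, and `V = ∑ Vⁱ ∂ᵢ ∘ x`
near `p`, then `∇_v V = ∑ v(Vⁱ) ∂ᵢ + ∇_{dx(v)} (∑ Vⁱ(p) ∂ᵢ)`, for `v` tangent to `M` at `p`. -/
def covAlong (cov : CovariantDerivative I' E' (TangentSpace I' : M' → Type _)) (x : M → M')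
    (V : ∀ p : M, TangentSpace I' (x p)) (p : M) : TangentSpace I p →L[ℝ] TangentSpace I' (x p) :=
  ((trivializationAt E' (TangentSpace I' : M' → Type _) (x p)).symmL ℝ (x p)) ∘L
      (mvfderiv I (coordsAlong x V p) p) +
    (cov (constField (x p) (coordsAlong x V p p)) (x p)) ∘L (mfderiv I I' x p)

lemma constField_add (q : M') (v w : E') :
    constField (I' := I') q (v + w) = constField q v + constField q w := by
  funext y; simp [constField]

lemma constField_smul (q : M') (a : ℝ) (w : E') :
    constField (I' := I') q (a • w) = a • constField q w := by
  funext y; simp [constField]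

lemma mdifferentiableAt_constField (q : M') (w : E') :
    MDiffAt (T% (constField (I' := I') q w)) q := by
  have hq : q ∈ (trivializationAt E' (TangentSpace I' : M' → Type _) q).baseSet :=
    FiberBundle.mem_baseSet_trivializationAt' q
  refine (FiberBundle.mdifferentiableAt_extend I' E' (constField (I' := I') q w q)).congr_of_eventuallyEq
    ?_
  filter_upwards [(trivializationAt E' (TangentSpace I' : M' → Type _) q).open_baseSet.mem_nhds hq]
    with y hy
  simp only [FiberBundle.extend, constField]
  rw [Bundle.Trivialization.symmL_apply _ hy, Bundle.Trivialization.symmL_apply _ hq,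
    Bundle.Trivialization.apply_mk_symm _ hq]

lemma mdifferentiableAt_coordsAlong {x : M → M'} {V : ∀ p : M, TangentSpace I' (x p)} {p : M}
    (hV : MDifferentiableAt I I'.tangent (fun y ↦ (⟨x y, V y⟩ : TangentBundle I' M')) p) :
    MDifferentiableAt I 𝓘(ℝ, E') (coordsAlong x V p) p := by
  have h := hV
  rw [mdifferentiableAt_totalSpace] at h
  refine h.2.congr_of_eventuallyEq ?_
  have hx : ContinuousAt x p := h.1.continuousAt
  have hb := hx.preimage_mem_nhds ((trivializationAt E' (TangentSpace I' : M' → Type _)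
    (x p)).open_baseSet.mem_nhds (FiberBundle.mem_baseSet_trivializationAt' (x p)))
  filter_upwards [hb] with y hy
  exact congrFun (Bundle.Trivialization.coe_linearMapAt_of_mem (R := ℝ)
    (trivializationAt E' (TangentSpace I' : M' → Type _) (x p)) hy) (V y)

lemma covAlong_add
    (cov : CovariantDerivative I' E' (TangentSpace I' : M' → Type _)) {x : M → M'}
    {V W : ∀ p : M, TangentSpace I' (x p)} {p : M}
    (hV : MDifferentiableAt I I'.tangent (fun y ↦ (⟨x y, V y⟩ : TangentBundle I' M')) p)
    (hW : MDifferentiableAt I I'.tangent (fun y ↦ (⟨x y, W y⟩ : TangentBundle I' M')) p) :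
    covAlong (I := I) cov x (fun y ↦ V y + W y) p = covAlong cov x V p + covAlong cov x W p := by
  have hc : coordsAlong (I' := I') x (fun y ↦ V y + W y) p =
      coordsAlong x V p + coordsAlong x W p := by
    funext y; simp [coordsAlong]
  have h1 := mdifferentiableAt_coordsAlong hV
  have h2 := mdifferentiableAt_coordsAlong hW
  simp only [covAlong]
  rw [hc, mvfderiv_add h1 h2, Pi.add_apply, constField_add,
    cov.isCovariantDerivativeOnUniv.add (mdifferentiableAt_constField _ _)
      (mdifferentiableAt_constField _ _)]
  simp only [ContinuousLinearMap.comp_add, ContinuousLinearMap.add_comp]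
  abel

lemma covAlong_smul
    (cov : CovariantDerivative I' E' (TangentSpace I' : M' → Type _)) {x : M → M'}
    {V : ∀ p : M, TangentSpace I' (x p)} {f : M → ℝ} {p : M}
    (hV : MDifferentiableAt I I'.tangent (fun y ↦ (⟨x y, V y⟩ : TangentBundle I' M')) p)
    (hf : MDifferentiableAt I 𝓘(ℝ, ℝ) f p) :
    covAlong (I := I) cov x (fun y ↦ f y • V y) p =
      f p • covAlong cov x V p + (mvfderiv I f p).smulRight (V p) := by
  have hc : coordsAlong (I' := I') x (fun y ↦ f y • V y) p = f • coordsAlong x V p := by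
    funext y; simp [coordsAlong]
  have h1 := mdifferentiableAt_coordsAlong hV
  have hq : x p ∈ (trivializationAt E' (TangentSpace I' : M' → Type _) (x p)).baseSet :=
    FiberBundle.mem_baseSet_trivializationAt' (x p)
  ext v
  simp only [covAlong]
  rw [hc, mvfderiv_smul hf h1, Pi.smul_apply', constField_smul,
    cov.isCovariantDerivativeOnUniv.smul_const _ (mdifferentiableAt_constField _ _)]
  have h3 : (trivializationAt E' (TangentSpace I' : M' → Type _) (x p)).symmL ℝ (x p)
      (coordsAlong x V p p) = V p :=
    Bundle.Trivialization.symmL_continuousLinearMapAt _ hq (V p)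
  simp only [add_apply, ContinuousLinearMap.comp_apply,
    smul_apply, ContinuousLinearMap.smulRight_apply, map_add, map_smul, h3,
    smul_add]
  abel

/-- Along a map `x`, the covariant derivative of the restriction of a vector field of `M'` is the
covariant derivative of that vector field. -/
lemma covAlong_comp [FiniteDimensional ℝ E']
    (cov : CovariantDerivative I' E' (TangentSpace I' : M' → Type _)) {x : M → M'}
    {V : ∀ q : M', TangentSpace I' q} {p : M} (hx : MDifferentiableAt I I' x p)
    (hV : MDiffAt (T% V) (x p)) (v : TangentSpace I p) :
    covAlong cov x (fun y ↦ V (x y)) p v = cov V (x p) (mfderiv I I' x p v) := by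
  set q := x p with hq
  set t := trivializationAt E' (TangentSpace I' : M' → Type _) q with ht
  have hqt : q ∈ t.baseSet := FiberBundle.mem_baseSet_trivializationAt' q
  let b := Module.finBasis ℝ E'
  let c : M' → E' := fun y ↦ t.continuousLinearMapAt ℝ y (V y)
  have hc : MDifferentiableAt I' 𝓘(ℝ, E') c q :=
    mdifferentiableAt_coordsAlong (x := fun y : M' ↦ y) hV
  let ci : Fin (Module.finrank ℝ E') → M' → ℝ := fun i y ↦ b.coord i (c y)
  have hci : ∀ i, HasMFDerivAt I' 𝓘(ℝ, ℝ) (ci i) q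
      ((LinearMap.toContinuousLinearMap (b.coord i)) ∘L (mfderiv I' 𝓘(ℝ, E') c q)) := fun i ↦
    (LinearMap.toContinuousLinearMap (b.coord i)).hasMFDerivAt.comp q hc.hasMFDerivAt
  let e : Fin (Module.finrank ℝ E') → ∀ y : M', TangentSpace I' y := fun i ↦
    constField q (b i)
  have he : ∀ i, MDiffAt (T% (e i)) q := fun i ↦ mdifferentiableAt_constField _ _
  have hterm : ∀ i, MDiffAt (T% (ci i • e i)) q := fun i ↦
    MDifferentiableAt.smul_section (hci i).mdifferentiableAt (he i)
  have hVe : ∀ᶠ y in 𝓝 q, V y = (∑ i, ci i • e i) y := by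
    filter_upwards [t.open_baseSet.mem_nhds hqt] with y hy
    have h1 : (∑ i, ci i • e i) y = t.symmL ℝ y (∑ i, b.repr (c y) i • b i) := by
      simp only [Finset.sum_apply, Pi.smul_apply', map_sum, map_smul]
      rfl
    rw [h1, b.sum_repr]
    exact (t.symmL_continuousLinearMapAt hy (V y)).symm
  have hsum : ∀ s : Finset (Fin (Module.finrank ℝ E')), MDiffAt (T% (∑ i ∈ s, ci i • e i)) q ∧
      cov (∑ i ∈ s, ci i • e i) q = ∑ i ∈ s, (ci i q • cov (e i) q +
        (mvfderiv I' (ci i) q).smulRight (e i q)) := by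
    intro s
    induction s using Finset.induction_on with
    | empty =>
      simp only [Finset.sum_empty]
      exact ⟨mdifferentiableAt_zeroSection .., by simp⟩
    | insert i s hi ih =>
      rw [Finset.sum_insert hi, Finset.sum_insert hi]
      exact ⟨mdifferentiableAt_add_section (hterm i) ih.1, by
        rw [cov.isCovariantDerivativeOnUniv.add (hterm i) ih.1, ih.2,
          cov.isCovariantDerivativeOnUniv.leibniz (he i) (hci i).mdifferentiableAt]⟩
  have hconst : ∀ s : Finset (Fin (Module.finrank ℝ E')),
      cov (constField q (∑ i ∈ s, ci i q • b i)) q = ∑ i ∈ s, ci i q • cov (e i) q := by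
    intro s
    induction s using Finset.induction_on with
    | empty =>
      simp only [Finset.sum_empty]
      have : constField (I' := I') q (0 : E') = 0 := by funext y; simp [constField]
      rw [this]; simp
    | insert i s hi ih =>
      rw [Finset.sum_insert hi, Finset.sum_insert hi, constField_add,
        cov.isCovariantDerivativeOnUniv.add (mdifferentiableAt_constField _ _)
          (mdifferentiableAt_constField _ _), ih, constField_smul,
        cov.isCovariantDerivativeOnUniv.smul_const _ (mdifferentiableAt_constField _ _)]
  have hcq : ∑ i, ci i q • b i = c q := b.sum_repr (c q)
  have hD : mvfderiv I (coordsAlong (I' := I') x (fun y ↦ V (x y)) p) p v =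
      mvfderiv I' c q (mfderiv I I' x p v) := by
    have : coordsAlong (I' := I') x (fun y ↦ V (x y)) p = c ∘ x := rfl
    rw [this, mvfderiv, mfderiv_comp p hc hx]
    rfl
  have hdi : ∀ i w, mvfderiv I' (ci i) q w = b.repr (mvfderiv I' c q w) i := by
    intro i w
    rw [mvfderiv, (hci i).mfderiv]
    rfl
  rw [cov.isCovariantDerivativeOnUniv.congr_of_eventuallyEq hV (hsum Finset.univ).1
    Filter.univ_mem hVe, (hsum Finset.univ).2, Finset.sum_add_distrib, ← hconst, hcq]
  simp only [covAlong, add_apply, ContinuousLinearMap.comp_apply, hD]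
  rw [add_comm]
  congr 1
  simp only [sum_apply, ContinuousLinearMap.smulRight_apply, hdi, e, constField]
  have h4 : ∀ d : E', t.symmL ℝ q d = ∑ i, b.repr d i • t.symmL ℝ q (b i) := by
    intro d
    conv_lhs => rw [← b.sum_repr d, map_sum]
    simp only [map_smul]
  exact h4 _

end General

/-! ### Rigged null hypersurfaces -/

section Hypersurface

variable {n : ℕ} {M' : Type*} [TopologicalSpace M'] [ChartedSpace (EuclideanSpace ℝ (Fin (n + 1))) M']
  [IsManifold (𝓡 (n + 1)) ∞ M']

/-- A null hypersurface of a semi-Riemannian manifold `(M', g')` of dimension `n + 1`, given by a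
smooth embedding `x` of an `n`-dimensional manifold `M`, together with a null rigging `N`. -/
structure RiggedNullHypersurface (g' : SemiRiemannianMetric (𝓡 (n + 1)) M')
    (M : Type*) [TopologicalSpace M] [ChartedSpace (EuclideanSpace ℝ (Fin n)) M]
    [IsManifold (𝓡 n) ∞ M] where
  /-- the embedding -/
  x : M → M'
  isSmoothEmbedding : IsSmoothEmbedding (𝓡 n) (𝓡 (n + 1)) ∞ x
  /-- the metric induced on `M` is degenerate at every point -/
  null : ∀ p : M, ∃ u : TangentSpace (𝓡 n) p, u ≠ 0 ∧ ∀ v : TangentSpace (𝓡 n) p,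
    g'.val (x p) (mfderiv (𝓡 n) (𝓡 (n + 1)) x p u) (mfderiv (𝓡 n) (𝓡 (n + 1)) x p v) = 0
  /-- the open neighbourhood of the hypersurface on which the rigging is defined -/
  U : Set M'
  isOpen_U : IsOpen U
  range_subset : range x ⊆ U
  /-- the rigging (its values outside `U` are irrelevant) -/
  N : ∀ q : M', TangentSpace (𝓡 (n + 1)) q
  contMDiffOn_N : ContMDiffOn (𝓡 (n + 1)) (𝓡 (n + 1)).tangent ∞
    (fun q ↦ (⟨q, N q⟩ : TangentBundle (𝓡 (n + 1)) M')) U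
  transverse : ∀ p : M, N (x p) ∉ range (mfderiv (𝓡 n) (𝓡 (n + 1)) x p)
  lightlike : ∀ p : M, g'.val (x p) (N (x p)) (N (x p)) = 0

namespace RiggedNullHypersurface

variable {g' : SemiRiemannianMetric (𝓡 (n + 1)) M'}
  {M : Type*} [TopologicalSpace M] [ChartedSpace (EuclideanSpace ℝ (Fin n)) M]
  [IsManifold (𝓡 n) ∞ M] (S : RiggedNullHypersurface g' M)

/-- The differential of the embedding. -/
abbrev dx (p : M) : TangentSpace (𝓡 n) p →L[ℝ] TangentSpace (𝓡 (n + 1)) (S.x p) :=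
  mfderiv (𝓡 n) (𝓡 (n + 1)) S.x p

/-- The induced (degenerate) metric `g = x^* g'`. -/
def g (p : M) (u v : TangentSpace (𝓡 n) p) : ℝ := g'.val (S.x p) (S.dx p u) (S.dx p v)

/-- The 1-form `η = x^* g'(N, ·)`. -/
def eta (p : M) : TangentSpace (𝓡 n) p →L[ℝ] ℝ :=
  (g'.val (S.x p) (S.N (S.x p))) ∘L (S.dx p)

/-- The rigged null hypersurface is closed: `dη = 0`. -/
def IsClosed : Prop := IsClosedForm S.eta

/-- The screen distribution `ker η`. -/
def screen (p : M) : Submodule ℝ (TangentSpace (𝓡 n) p) := LinearMap.ker (S.eta p).toLinearMap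

/-- The `α`-associated metric `g_α = g + α η ⊗ η`. -/
def assocMetric (α : M → ℝ) (p : M) (u v : TangentSpace (𝓡 n) p) : ℝ :=
  S.g p u v + α p * (S.eta p u * S.eta p v)

lemma dx_injective (p : M) : Function.Injective (S.dx p) := by
  have h : IsImmersionAt (𝓡 n) (𝓡 (n + 1)) ∞ S.x p := S.isSmoothEmbedding.isImmersion.isImmersionAt p
  set φ := h.domChart.extend (𝓡 n) with hφ
  set ψ := h.codChart.extend (𝓡 (n + 1)) with hψ
  have hps := h.mem_domChart_source
  have hx : MDifferentiableAt (𝓡 n) (𝓡 (n + 1)) S.x p :=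
    S.isSmoothEmbedding.contMDiff.mdifferentiableAt (by simp)
  have hσd : MDifferentiableAt 𝓘(ℝ, EuclideanSpace ℝ (Fin n)) (𝓡 n) φ.symm (φ p) := by
    have h1 := contMDiffOn_extend_symm h.domChart_mem_maximalAtlas
    refine (h1.contMDiffAt ?_).mdifferentiableAt (by simp)
    simp only [modelWithCornersSelf_coe, image_id]
    exact h.domChart.open_target.mem_nhds (h.domChart.map_source hps)
  have hψd : MDifferentiableAt (𝓡 (n + 1)) 𝓘(ℝ, EuclideanSpace ℝ (Fin (n + 1))) ψ (S.x p) :=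
    (h.codChart.contMDiffAt_extend h.codChart_mem_maximalAtlas
      h.mem_codChart_source).mdifferentiableAt (by simp)
  let L : EuclideanSpace ℝ (Fin (n + 1)) →L[ℝ] EuclideanSpace ℝ (Fin n) :=
    (ContinuousLinearMap.fst ℝ _ _) ∘L h.equiv.symm.toContinuousLinearMap
  have hL : ∀ y ∈ h.domChart.source, L (ψ (S.x y)) = φ y := by
    intro y hy
    have hy' : y ∈ φ.source := by rw [hφ, h.domChart.extend_source]; exact hy
    have h2 := h.writtenInCharts (φ.map_source hy')
    simp only [Function.comp_apply] at h2
    rw [← hφ, ← hψ, φ.left_inv hy'] at h2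
    rw [h2]
    simp [L]
  have hG : MDifferentiableAt (𝓡 (n + 1)) (𝓡 n) (φ.symm ∘ L ∘ ψ) (S.x p) := by
    refine MDifferentiableAt.comp (I' := 𝓘(ℝ, EuclideanSpace ℝ (Fin n))) _ ?_ ?_
    · simp only [Function.comp_apply]
      rw [hL p hps]
      exact hσd
    · exact L.mdifferentiableAt.comp _ hψd
  have hid : (φ.symm ∘ L ∘ ψ) ∘ S.x =ᶠ[𝓝 p] id := by
    filter_upwards [h.domChart.open_source.mem_nhds hps] with y hy
    have hy' : y ∈ φ.source := by rw [hφ, h.domChart.extend_source]; exact hy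
    simp only [Function.comp_apply, id]
    rw [hL y hy, φ.left_inv hy']
  have hcomp := mfderiv_comp p hG hx
  rw [hid.mfderiv_eq, mfderiv_id] at hcomp
  intro u v huv
  have hu := congrArg (fun A ↦ A u) hcomp
  have hv := congrArg (fun A ↦ A v) hcomp
  change u = mfderiv _ _ _ _ (S.dx p u) at hu
  change v = mfderiv _ _ _ _ (S.dx p v) at hv
  rw [hu, hv, huv]

/-- The map `TM × ℝ → TM'|_M`, `(u, t) ↦ dx(u) + t N`. -/
def sumMap (p : M) : (TangentSpace (𝓡 n) p × ℝ) →ₗ[ℝ] TangentSpace (𝓡 (n + 1)) (S.x p) :=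
  (S.dx p).toLinearMap.coprod (LinearMap.toSpanSingleton ℝ _ (S.N (S.x p)))

lemma sumMap_apply (p : M) (u : TangentSpace (𝓡 n) p) (t : ℝ) :
    S.sumMap p (u, t) = S.dx p u + t • S.N (S.x p) := by
  simp [sumMap]

lemma sumMap_bijective (p : M) : Function.Bijective (S.sumMap p) := by
  have : FiniteDimensional ℝ (TangentSpace (𝓡 (n + 1)) (S.x p)) :=
    inferInstanceAs (FiniteDimensional ℝ (EuclideanSpace ℝ (Fin (n + 1))))
  have : FiniteDimensional ℝ (TangentSpace (𝓡 n) p) :=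
    inferInstanceAs (FiniteDimensional ℝ (EuclideanSpace ℝ (Fin n)))
  have h1 : Module.finrank ℝ (TangentSpace (𝓡 (n + 1)) (S.x p)) = n + 1 :=
    finrank_euclideanSpace_fin (𝕜 := ℝ) (n := n + 1)
  have h2 : Module.finrank ℝ (TangentSpace (𝓡 n) p) = n :=
    finrank_euclideanSpace_fin (𝕜 := ℝ) (n := n)
  have hinj : Function.Injective (S.sumMap p) := by
    rw [injective_iff_map_eq_zero]
    rintro ⟨u, t⟩ h
    rw [sumMap_apply] at h
    have ht : t = 0 := by
      by_contra ht
      refine S.transverse p ⟨-(t⁻¹ • u), ?_⟩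
      have h3 : S.dx p u = -(t • S.N (S.x p)) := eq_neg_of_add_eq_zero_left h
      change S.dx p _ = _
      rw [map_neg, map_smul, h3, smul_neg, neg_neg, smul_smul, inv_mul_cancel₀ ht, one_smul]
    subst ht
    rw [zero_smul, add_zero] at h
    rw [Prod.mk_eq_zero]
    exact ⟨S.dx_injective p (h.trans (map_zero _).symm), rfl⟩
  refine ⟨hinj, ?_⟩
  refine (LinearMap.injective_iff_surjective_of_finrank_eq_finrank ?_).1 hinj
  rw [Module.finrank_prod, h1, h2, Module.finrank_self]

lemma eq_zero_of_radical {p : M} {u : TangentSpace (𝓡 n) p} (hu : ∀ v, S.g p u v = 0)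
    (hN : g'.val (S.x p) (S.dx p u) (S.N (S.x p)) = 0) : u = 0 := by
  apply S.dx_injective p
  rw [map_zero]
  refine g'.nondegenerate _ _ fun w ↦ ?_
  obtain ⟨⟨v, t⟩, rfl⟩ := (S.sumMap_bijective p).2 w
  rw [sumMap_apply, map_add, map_smul, hN, smul_zero, add_zero]
  exact hu v

/-- There is a unique radical vector `ξ` with `g'(ξ, N) = 1`. -/
lemma existsUnique_xi (p : M) : ∃! ξ : TangentSpace (𝓡 n) p, (∀ v, S.g p ξ v = 0) ∧
    g'.val (S.x p) (S.dx p ξ) (S.N (S.x p)) = 1 := by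
  obtain ⟨u, hu0, hu⟩ := S.null p
  have hc : g'.val (S.x p) (S.dx p u) (S.N (S.x p)) ≠ 0 := fun h ↦ hu0 (S.eq_zero_of_radical hu h)
  set c := g'.val (S.x p) (S.dx p u) (S.N (S.x p)) with hcdef
  refine ⟨c⁻¹ • u, ⟨fun v ↦ ?_, ?_⟩, ?_⟩
  · have := hu v
    simp only [g, map_smul, smul_apply]
    rw [this, smul_zero]
  · simp only [map_smul, smul_apply]
    rw [← hcdef, smul_eq_mul, inv_mul_cancel₀ hc]
  · rintro w ⟨hw, hw1⟩
    rw [← sub_eq_zero]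
    refine S.eq_zero_of_radical (fun v ↦ ?_) ?_
    · have h1 := hu v
      have h2 := hw v
      simp only [g] at h2 ⊢
      simp only [map_sub, map_smul, sub_apply, smul_apply, h2, h1]
      simp
    · simp only [map_sub, map_smul, sub_apply, smul_apply, hw1]
      rw [← hcdef, smul_eq_mul, inv_mul_cancel₀ hc, sub_self]

/-- The rigged vector field `ξ`: the unique section of the radical bundle such that
`g'(ξ, N) = 1`. -/
def xi (p : M) : TangentSpace (𝓡 n) p := (S.existsUnique_xi p).choose

lemma xi_spec (p : M) : (∀ v, S.g p (S.xi p) v = 0) ∧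
    g'.val (S.x p) (S.dx p (S.xi p)) (S.N (S.x p)) = 1 :=
  (S.existsUnique_xi p).choose_spec.1

/-- The `α`-associated metric is nondegenerate where `α` does not vanish. -/
lemma assocMetric_nondegenerate {α : M → ℝ} {p : M} (hα : α p ≠ 0) {u : TangentSpace (𝓡 n) p}
    (hu : ∀ v, S.assocMetric α p u v = 0) : u = 0 := by
  have hxi : S.eta p (S.xi p) = 1 := by
    rw [eta, ContinuousLinearMap.comp_apply, g'.symm]; exact (S.xi_spec p).2
  have h0 : S.g p u (S.xi p) = 0 := by rw [g, g'.symm]; exact (S.xi_spec p).1 u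
  have h1 := hu (S.xi p)
  rw [assocMetric, h0, hxi, mul_one, zero_add] at h1
  have h2 : S.eta p u = 0 := (mul_eq_zero.1 h1).resolve_left hα
  refine S.eq_zero_of_radical (fun v ↦ ?_) ?_
  · have h3 := hu v
    rwa [assocMetric, h2, zero_mul, mul_zero, add_zero] at h3
  · rw [g'.symm]; exact h2

/-- The decomposition `TM'|_M = TM ⊕ span(N)`. -/
def decomp (p : M) : (TangentSpace (𝓡 n) p × ℝ) ≃ₗ[ℝ] TangentSpace (𝓡 (n + 1)) (S.x p) :=
  LinearEquiv.ofBijective (S.sumMap p) (S.sumMap_bijective p)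

/-- The projection of `TM'|_M` onto `TM` along `N`. -/
def tanProj (p : M) : TangentSpace (𝓡 (n + 1)) (S.x p) →L[ℝ] TangentSpace (𝓡 n) p :=
  haveI : FiniteDimensional ℝ (TangentSpace (𝓡 (n + 1)) (S.x p)) :=
    inferInstanceAs (FiniteDimensional ℝ (EuclideanSpace ℝ (Fin (n + 1))))
  haveI : T2Space (TangentSpace (𝓡 (n + 1)) (S.x p)) :=
    inferInstanceAs (T2Space (EuclideanSpace ℝ (Fin (n + 1))))
  LinearMap.toContinuousLinearMap (LinearMap.fst ℝ _ _ ∘ₗ (S.decomp p).symm.toLinearMap)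

lemma tanProj_dx (p : M) (u : TangentSpace (𝓡 n) p) : S.tanProj p (S.dx p u) = u := by
  have h : S.decomp p (u, 0) = S.dx p u := by
    change S.sumMap p (u, 0) = _
    rw [sumMap_apply, zero_smul, add_zero]
  change ((S.decomp p).symm (S.dx p u)).1 = u
  rw [← h, LinearEquiv.symm_apply_apply]

lemma mdifferentiableAt_dx {Y : ∀ p : M, TangentSpace (𝓡 n) p} {p : M}
    (hY : MDifferentiableAt (𝓡 n) (𝓡 n).tangent
      (fun y ↦ (⟨y, Y y⟩ : TangentBundle (𝓡 n) M)) p) : MDifferentiableAt (𝓡 n) (𝓡 (n + 1)).tangent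
      (fun y ↦ (⟨S.x y, S.dx y (Y y)⟩ : TangentBundle (𝓡 (n + 1)) M')) p :=
  ((S.isSmoothEmbedding.contMDiff.contMDiff_tangentMap (m := 1) (by decide)).mdifferentiableAt
    one_ne_zero).comp p hY

/-- The projection `P` of `TM` onto the screen distribution along `ξ`. -/
def P (p : M) (v : TangentSpace (𝓡 n) p) : TangentSpace (𝓡 n) p := v - S.eta p v • S.xi p

variable (nabla : CovariantDerivative (𝓡 (n + 1)) (EuclideanSpace ℝ (Fin (n + 1)))
    (TangentSpace (𝓡 (n + 1)) : M' → Type _))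

/-- The connection induced on `M` by a connection `∇'` of `M'`: `∇_v Y` is the tangential part of
`∇'_v (dx Y)` in the decomposition `TM'|_M = TM ⊕ span(N)`. -/
def inducedConnection : CovariantDerivative (𝓡 n) (EuclideanSpace ℝ (Fin n))
    (TangentSpace (𝓡 n) : M → Type _) where
  toFun Y p := (S.tanProj p) ∘L covAlong nabla S.x (fun y ↦ S.dx y (Y y)) p
  isCovariantDerivativeOnUniv :=
    { add := fun {Y Z p} hY hZ _ ↦ by
        have h : (fun y ↦ S.dx y ((Y + Z) y)) = fun y ↦ S.dx y (Y y) + S.dx y (Z y) := by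
          funext y; simp
        rw [h, covAlong_add nabla (S.mdifferentiableAt_dx hY) (S.mdifferentiableAt_dx hZ),
          ContinuousLinearMap.comp_add]
      leibniz := fun {Y f p} hY hf _ ↦ by
        have h : (fun y ↦ S.dx y ((f • Y) y)) = fun y ↦ f y • S.dx y (Y y) := by
          funext y; simp
        rw [h, covAlong_smul nabla (S.mdifferentiableAt_dx hY) hf]
        ext v
        simp [tanProj_dx] }

/-- The derivative `∇'_v N` of the rigging in a direction `v` tangent to `M`. -/
def derivN (p : M) (v : TangentSpace (𝓡 n) p) : TangentSpace (𝓡 (n + 1)) (S.x p) :=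
  nabla S.N (S.x p) (S.dx p v)

/-- The shape operator `A_N`, from the Weingarten formula `∇'_v N = -A_N v + τ(v) N`. -/
def shapeN (p : M) (v : TangentSpace (𝓡 n) p) : TangentSpace (𝓡 n) p :=
  -S.tanProj p (S.derivN nabla p v)

/-- The rotation 1-form `τ(v) = g'(∇'_v N, ξ)`. -/
def tau (p : M) (v : TangentSpace (𝓡 n) p) : ℝ :=
  g'.val (S.x p) (S.derivN nabla p v) (S.dx p (S.xi p))

/-- The shape operator `A*_ξ` of the screen distribution: `-A*_ξ v` is the screen component of
`∇_v ξ` in the decomposition `∇_v ξ = -A*_ξ v - τ(v) ξ`. -/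
def shapeXi (p : M) (v : TangentSpace (𝓡 n) p) : TangentSpace (𝓡 n) p :=
  -S.P p (S.inducedConnection nabla S.xi p v)

end RiggedNullHypersurface

end Hypersurface

end NullHyp

end

/-!
Write `B(X, Y) = g'(∇'_X Y, ξ)` for the second fundamental form. Everything rests on two covariant
derivatives with respect to the induced connection `∇`:

* `(∇_v g)(Y, Z) = B(v, Y) η(Z) + B(v, Z) η(Y)` (`RiggedNullHypersurface.mvfderiv_g`),
* `(∇_v η)(Y) = τ(v) η(Y) - g(A_N v, Y)` (`RiggedNullHypersurface.mvfderiv_eta`),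

both obtained by differentiating `g'(dx Y, dx Z)` and `g'(N, dx Y)` along the hypersurface and
splitting with the Gauss and Weingarten formulas. Since `g'(ξ, Y) = 0` on `M`, also
`B(v, Y) = g(A*_ξ v, Y)`. Hence
`(∇_v g_α)(Y, Z) = η(Z) g((A*_ξ - α A_N) v, Y) + η(Y) g((A*_ξ - α A_N) v, Z)
  + (dα(v) + 2 α τ(v)) η(Y) η(Z)`.
Evaluating on `ξ`, and using that `A*_ξ` and `A_N` take values in the screen distribution, on which
`g` is nondegenerate, this vanishes identically if and only if `A*_ξ = α A_N` and
`dα + 2 α τ = 0`; as `∇` is always torsion-free, this is the condition for `∇` to be the Levi-Civita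
connection of `g_α` (`RiggedNullHypersurface.isLeviCivita_assocMetric_iff`). For constant `α` this
is the condition with `τ = 0`.

If `α` is only constant on the leaves, it remains to show that, on a closed hypersurface with
`A*_ξ = α A_N`, the second condition holds automatically on the screen distribution.
First, `dα` vanishes there: through each screen vector passes an integral curve of a
screen vector field, and it stays in one leaf (`mvfderiv_eq_zero_of_eqOn_leaf`). Secondly, `dη = 0`
says that `g'(∇'_v N, u)` is symmetric in `u` and `v`, so that `τ(v) = -g(A_N ξ, v)` for `v` in the
screen distribution, and `α g(A_N ξ, v) = B(ξ, v) = B(v, ξ) = 0`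
(`RiggedNullHypersurface.IsClosed.tau_eq_zero`).

Vector fields along the embedding `x` are treated by extending them to `M'` by means of a local left
inverse of `x`, and symmetry statements are checked on the coordinate fields `constField`, whose
brackets vanish.
-/

/-! ### Smooth metrics and coordinate vector fields -/

namespace NullHyp

section Smoothness

variable {E : Type*} [NormedAddCommGroup E] [NormedSpace ℝ E]
  {H : Type*} [TopologicalSpace H] {I : ModelWithCorners ℝ E H}
  {M : Type*} [TopologicalSpace M] [ChartedSpace H M] [IsManifold I ∞ M]
  {E₀ : Type*} [NormedAddCommGroup E₀] [NormedSpace ℝ E₀]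
  {H₀ : Type*} [TopologicalSpace H₀] {I₀ : ModelWithCorners ℝ E₀ H₀}
  {X : Type*} [TopologicalSpace X] [ChartedSpace H₀ X]

lemma SemiRiemannianMetric.contMDiffAt_apply (g : SemiRiemannianMetric I M) {b : X → M}
    {V W : ∀ y, TangentSpace I (b y)} {p : X} {k : ℕ∞}
    (hV : ContMDiffAt I₀ I.tangent k (fun y ↦ (⟨b y, V y⟩ : TangentBundle I M)) p)
    (hW : ContMDiffAt I₀ I.tangent k (fun y ↦ (⟨b y, W y⟩ : TangentBundle I M)) p) :
    ContMDiffAt I₀ 𝓘(ℝ, ℝ) k (fun y ↦ g.val (b y) (V y) (W y)) p := by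
  have hb : ContMDiffAt I₀ I k b p := (contMDiffAt_totalSpace.1 hV).1
  have : ContMDiffAt I₀ (I.prod 𝓘(ℝ, ℝ)) k
      (fun m ↦ TotalSpace.mk' ℝ (E := Bundle.Trivial M ℝ) (b m) (g.val (b m) (V m) (W m))) p := by
    apply ContMDiffAt.clm_bundle_apply₂ (F₁ := E) (F₂ := E)
    · exact (g.contMDiff.of_le (by exact_mod_cast le_top)).contMDiffAt.comp p hb
    · exact hV
    · exact hW
  exact (contMDiffAt_totalSpace.1 this).2

lemma SemiRiemannianMetric.mdifferentiableAt_apply (g : SemiRiemannianMetric I M) {b : X → M}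
    {V W : ∀ y, TangentSpace I (b y)} {p : X}
    (hV : MDifferentiableAt I₀ I.tangent (fun y ↦ (⟨b y, V y⟩ : TangentBundle I M)) p)
    (hW : MDifferentiableAt I₀ I.tangent (fun y ↦ (⟨b y, W y⟩ : TangentBundle I M)) p) :
    MDifferentiableAt I₀ 𝓘(ℝ, ℝ) (fun y ↦ g.val (b y) (V y) (W y)) p := by
  have hb : MDifferentiableAt I₀ I b p := ((mdifferentiableAt_totalSpace _ _).1 hV).1
  have : MDifferentiableAt I₀ (I.prod 𝓘(ℝ, ℝ))
      (fun m ↦ TotalSpace.mk' ℝ (E := Bundle.Trivial M ℝ) (b m) (g.val (b m) (V m) (W m))) p := by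
    apply MDifferentiableAt.clm_bundle_apply₂ (F₁ := E) (F₂ := E)
    · exact (g.contMDiff.mdifferentiableAt (by simp)).comp p hb
    · exact hV
    · exact hW
  exact ((mdifferentiableAt_totalSpace _ _).1 this).2

lemma contMDiffAt_constField (q : M) (w : E) :
    ContMDiffAt I I.tangent ∞ (T% (constField (I' := I) q w)) q := by
  have hq : q ∈ (trivializationAt E (TangentSpace I : M → Type _) q).baseSet :=
    FiberBundle.mem_baseSet_trivializationAt' q
  rw [contMDiffAt_section]
  refine (contMDiffAt_const (c := w)).congr_of_eventuallyEq ?_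
  filter_upwards [(trivializationAt E (TangentSpace I : M → Type _) q).open_baseSet.mem_nhds hq]
    with y hy
  simp only [constField]
  rw [Bundle.Trivialization.symmL_apply _ hy, Bundle.Trivialization.apply_mk_symm _ hy]

lemma constField_self (q : M) (v : TangentSpace I q) :
    constField (I' := I) q ((trivializationAt E (TangentSpace I : M → Type _) q).continuousLinearMapAt
      ℝ q v) q = v :=
  Bundle.Trivialization.symmL_continuousLinearMapAt _
    (FiberBundle.mem_baseSet_trivializationAt' q) v

lemma mfderiv_extChartAt_constField (q : M) (w : E) {y : M} (hy : y ∈ (chartAt H q).source) :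
    mfderiv I 𝓘(ℝ, E) (extChartAt I q) y (constField (I' := I) q w y) = w := by
  rw [← TangentBundle.continuousLinearMapAt_trivializationAt hy]
  exact Bundle.Trivialization.continuousLinearMapAt_symmL _ (by simpa using hy) w

lemma mlieBracket_constField [I.Boundaryless] (q : M) (v w : E) :
    VectorField.mlieBracket I (constField (I' := I) q v) (constField q w) q = 0 := by
  have key : ∀ u : E, VectorField.mpullbackWithin 𝓘(ℝ, E) I (extChartAt I q).symm
      (constField (I' := I) q u) (range I) =ᶠ[𝓝 (extChartAt I q q)] fun _ ↦ u := by
    intro u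
    filter_upwards [extChartAt_target_mem_nhds (I := I) q] with z hz
    have hy : (extChartAt I q).symm z ∈ (chartAt H q).source := by
      simpa using (extChartAt I q).map_target hz
    rw [VectorField.mpullbackWithin_apply]
    have h1 := isInvertible_mfderivWithin_extChartAt_symm hz
    simp only [constField]
    rw [TangentBundle.symmL_trivializationAt hy, (extChartAt I q).right_inv hz]
    exact h1.inverse_apply_eq.2 rfl
  rw [← VectorField.mlieBracketWithin_univ, VectorField.mlieBracketWithin_apply]
  simp only [preimage_univ, univ_inter]
  have hv := (key v).filter_mono (nhdsWithin_le_nhds (s := range I))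
  have hw := (key w).filter_mono (nhdsWithin_le_nhds (s := range I))
  rw [hv.lieBracketWithin_vectorField_eq (key v).self_of_nhds hw (key w).self_of_nhds]
  simp only [VectorField.lieBracketWithin, fderivWithin_fun_const, Pi.zero_apply, zero_apply,
    sub_zero]
  exact map_zero _

end Smoothness

end NullHyp

/-! ### Covariant differentiation along a map -/

namespace NullHyp

section Along

variable {E : Type*} [NormedAddCommGroup E] [NormedSpace ℝ E]
  {H : Type*} [TopologicalSpace H] {I : ModelWithCorners ℝ E H}
  {M : Type*} [TopologicalSpace M] [ChartedSpace H M]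
  {E' : Type*} [NormedAddCommGroup E'] [NormedSpace ℝ E']
  {H' : Type*} [TopologicalSpace H'] {I' : ModelWithCorners ℝ E' H'}
  {M' : Type*} [TopologicalSpace M'] [ChartedSpace H' M'] [IsManifold I' ∞ M']
  {x : M → M'} {p : M}

lemma covAlong_congr (cov : CovariantDerivative I' E' (TangentSpace I' : M' → Type _))
    {V W : ∀ p : M, TangentSpace I' (x p)} (h : ∀ᶠ y in 𝓝 p, V y = W y) :
    covAlong (I := I) cov x V p = covAlong cov x W p := by
  have hc : coordsAlong x V p =ᶠ[𝓝 p] coordsAlong x W p := by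
    filter_upwards [h] with y hy
    simp only [coordsAlong, hy]
  simp only [covAlong, mvfderiv, hc.mfderiv_eq, hc.self_of_nhds]
  rfl

/-- A vector field along `x` extends to the target, near a point at which `x` has a differentiable
local left inverse `r`: keep the coordinates constant along the fibres of `r`. -/
lemma exists_extension_of_leftInverse {r : M' → M} (hr : MDifferentiableAt I' I r (x p))
    (hrx : ∀ᶠ y in 𝓝 p, r (x y) = y) {V : ∀ p : M, TangentSpace I' (x p)}
    (hV : MDifferentiableAt I I'.tangent (fun y ↦ (⟨x y, V y⟩ : TangentBundle I' M')) p) :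
    ∃ V' : ∀ q : M', TangentSpace I' q, MDiffAt (T% V') (x p) ∧
      ∀ᶠ y in 𝓝 p, V y = V' (x y) := by
  set t := trivializationAt E' (TangentSpace I' : M' → Type _) (x p) with ht
  have hq : x p ∈ t.baseSet := FiberBundle.mem_baseSet_trivializationAt' (x p)
  have hx : ContinuousAt x p := ((mdifferentiableAt_totalSpace _ _).1 hV).1.continuousAt
  refine ⟨fun q ↦ t.symmL ℝ q (coordsAlong x V p (r q)), ?_, ?_⟩
  · rw [mdifferentiableAt_section]
    have hp : r (x p) = p := hrx.self_of_nhds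
    have hc : MDifferentiableAt I' 𝓘(ℝ, E') (fun q ↦ coordsAlong x V p (r q)) (x p) :=
      MDifferentiableAt.comp (x p) (by rw [hp]; exact mdifferentiableAt_coordsAlong hV) hr
    refine hc.congr_of_eventuallyEq ?_
    filter_upwards [t.open_baseSet.mem_nhds hq] with y hy
    rw [Bundle.Trivialization.symmL_apply _ hy, Bundle.Trivialization.apply_mk_symm _ hy]
  · filter_upwards [hrx, hx.preimage_mem_nhds (t.open_baseSet.mem_nhds hq)] with y hy hb
    rw [hy]
    exact (Bundle.Trivialization.symmL_continuousLinearMapAt _ hb (V y)).symm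

/-- The Levi-Civita connection is metric for vector fields along a map with a differentiable local left
inverse. -/
lemma IsLeviCivita.mvfderiv_along [FiniteDimensional ℝ E'] [CompleteSpace E']
    {g : SemiRiemannianMetric I' M'}
    {cov : CovariantDerivative I' E' (TangentSpace I' : M' → Type _)}
    (h : IsLeviCivita (fun q u v ↦ g.val q u v) cov)
    (hx : MDifferentiableAt I I' x p) {r : M' → M} (hr : MDifferentiableAt I' I r (x p))
    (hrx : ∀ᶠ y in 𝓝 p, r (x y) = y) {V W : ∀ p : M, TangentSpace I' (x p)}
    (hV : MDifferentiableAt I I'.tangent (fun y ↦ (⟨x y, V y⟩ : TangentBundle I' M')) p)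
    (hW : MDifferentiableAt I I'.tangent (fun y ↦ (⟨x y, W y⟩ : TangentBundle I' M')) p)
    (v : TangentSpace I p) :
    mvfderiv I (fun y ↦ g.val (x y) (V y) (W y)) p v =
      g.val (x p) (covAlong cov x V p v) (W p) + g.val (x p) (V p) (covAlong cov x W p v) := by
  obtain ⟨V', hV', hVV⟩ := exists_extension_of_leftInverse hr hrx hV
  obtain ⟨W', hW', hWW⟩ := exists_extension_of_leftInverse hr hrx hW
  have hf : (fun y ↦ g.val (x y) (V y) (W y)) =ᶠ[𝓝 p]
      (fun q ↦ g.val q (V' q) (W' q)) ∘ x := by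
    filter_upwards [hVV, hWW] with y h1 h2
    simp only [Function.comp_apply, h1, h2]
  have hd : MDifferentiableAt I' 𝓘(ℝ, ℝ) (fun q ↦ g.val q (V' q) (W' q)) (x p) :=
    g.mdifferentiableAt_apply (b := fun q ↦ q) hV' hW'
  have h1 : mvfderiv I (fun y ↦ g.val (x y) (V y) (W y)) p v =
      mvfderiv I' (fun q ↦ g.val q (V' q) (W' q)) (x p) (mfderiv I I' x p v) := by
    rw [mvfderiv, hf.mfderiv_eq, mfderiv_comp p hd hx]
    rfl
  rw [h1, h.metric _ _ _ hV' hW', covAlong_congr cov hVV, covAlong_congr cov hWW,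
    covAlong_comp cov hx hV', covAlong_comp cov hx hW', hVV.self_of_nhds, hWW.self_of_nhds]

/-- In charts this is the symmetry of the second derivative of `x`. -/
lemma mvfderiv_coordsAlong_mfderiv_constField_comm [IsManifold I ∞ M] [I.Boundaryless]
    (hx : ContMDiff I I' ∞ x) (u w : E) :
    mvfderiv I (coordsAlong x (fun y ↦ mfderiv I I' x y (constField (I' := I) p w y)) p) p
        (constField (I' := I) p u p) =
      mvfderiv I (coordsAlong x (fun y ↦ mfderiv I I' x y (constField (I' := I) p u y)) p) p
        (constField (I' := I) p w p) := by
  set F : E → E' := extChartAt I' (x p) ∘ x ∘ (extChartAt I p).symm with hF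
  have hxF : ContDiffAt ℝ ∞ F (extChartAt I p p) := by
    have := (contMDiffAt_iff.1 (hx p)).2
    rwa [I.range_eq_univ, contDiffWithinAt_univ] at this
  have hcoord : ∀ w : E, coordsAlong x (fun y ↦ mfderiv I I' x y (constField (I' := I) p w y)) p
      =ᶠ[𝓝 p] (fun z ↦ fderiv ℝ F z w) ∘ extChartAt I p := by
    intro w
    filter_upwards [(chartAt H p).open_source.mem_nhds (mem_chart_source H p),
      hx.continuous.continuousAt.preimage_mem_nhds
        ((chartAt H' (x p)).open_source.mem_nhds (mem_chart_source H' (x p)))] with y h2 h3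
    have h2' : y ∈ (extChartAt I p).source := by simpa using h2
    have hFx : F ∘ extChartAt I p =ᶠ[𝓝 y] extChartAt I' (x p) ∘ x := by
      filter_upwards [(isOpen_extChartAt_source (I := I) p).mem_nhds h2'] with z hz
      simp only [hF, Function.comp_apply, (extChartAt I p).left_inv hz]
    have hd1 : MDifferentiableAt I' 𝓘(ℝ, E') (extChartAt I' (x p)) (x y) :=
      mdifferentiableAt_extChartAt h3
    have hd2 : MDifferentiableAt I 𝓘(ℝ, E) (extChartAt I p) y := mdifferentiableAt_extChartAt h2
    have hd3 : MDifferentiableAt I I' x y := (hx y).mdifferentiableAt (by simp)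
    have hdF : MDifferentiableAt 𝓘(ℝ, E) 𝓘(ℝ, E') F (extChartAt I p y) := by
      have hz : (extChartAt I p).symm (extChartAt I p y) = y := (extChartAt I p).left_inv h2'
      have hsymm : MDifferentiableAt 𝓘(ℝ, E) I (extChartAt I p).symm (extChartAt I p y) := by
        have := mdifferentiableWithinAt_extChartAt_symm ((extChartAt I p).map_source h2')
        rwa [I.range_eq_univ, mdifferentiableWithinAt_univ] at this
      have h4 : MDifferentiableAt 𝓘(ℝ, E) I' (x ∘ (extChartAt I p).symm) (extChartAt I p y) :=
        MDifferentiableAt.comp _ (by rw [hz]; exact hd3) hsymm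
      exact MDifferentiableAt.comp _ (by simpa only [Function.comp_apply, hz] using hd1) h4
    have hc := mfderiv_comp y hdF hd2
    rw [hFx.mfderiv_eq, mfderiv_comp y hd1 hd3, mfderiv_eq_fderiv] at hc
    have := congrArg (fun A ↦ A (constField (I' := I) p w y)) hc
    simp only [coordsAlong, Function.comp_apply]
    rw [TangentBundle.continuousLinearMapAt_trivializationAt h3]
    refine this.trans ?_
    change fderiv ℝ F _ (mfderiv I 𝓘(ℝ, E) (extChartAt I p) y (constField (I' := I) p w y)) = _
    rw [mfderiv_extChartAt_constField p w h2]
  have hdd : DifferentiableAt ℝ (fderiv ℝ F) (extChartAt I p p) :=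
    (hxF.fderiv_right (m := 1) (by decide)).differentiableAt one_ne_zero
  have hderiv : ∀ u w : E,
      mvfderiv I (coordsAlong x (fun y ↦ mfderiv I I' x y (constField (I' := I) p w y)) p) p
        (constField (I' := I) p u p) = fderiv ℝ (fderiv ℝ F) (extChartAt I p p) u w := by
    intro u w
    -- `F` is the coordinate expression of `x`, and `fderiv ℝ F · w` that of `dx(constField p w)`
    have h1 : HasFDerivAt (fun z ↦ fderiv ℝ F z w)
        ((fderiv ℝ (fderiv ℝ F) (extChartAt I p p)).flip w) (extChartAt I p p) := by
      have := hdd.hasFDerivAt.clm_apply (hasFDerivAt_const w (extChartAt I p p))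
      simpa using! this
    have h2 := h1.hasMFDerivAt.comp p
      (mdifferentiableAt_extChartAt (I := I) (mem_chart_source H p)).hasMFDerivAt
    rw [mvfderiv, (hcoord w).mfderiv_eq, h2.mfderiv]
    change fderiv ℝ (fderiv ℝ F) (extChartAt I p p)
      (mfderiv I 𝓘(ℝ, E) (extChartAt I p) p (constField (I' := I) p u p)) w = _
    rw [mfderiv_extChartAt_constField p u (mem_chart_source H p)]
  rw [hderiv, hderiv]
  exact (hxF.isSymmSndFDerivAt (by simp; decide)).eq u w

/-- A torsion-free connection satisfies `∇_U (dx W) = ∇_W (dx U)` for coordinate fields `U`, `W`,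
as `[U, W] = 0`. -/
lemma covAlong_mfderiv_constField_comm [IsManifold I ∞ M] [I.Boundaryless] [I'.Boundaryless]
    [FiniteDimensional ℝ E'] [CompleteSpace E'] {cov : CovariantDerivative I' E' (TangentSpace I' : M' → Type _)}
    (hcov : cov.torsion = 0) (hx : ContMDiff I I' ∞ x) (u w : E) :
    covAlong cov x (fun y ↦ mfderiv I I' x y (constField (I' := I) p w y)) p
        (constField (I' := I) p u p) =
      covAlong cov x (fun y ↦ mfderiv I I' x y (constField (I' := I) p u y)) p
        (constField (I' := I) p w p) := by
  have key : ∀ a b : TangentSpace I' (x p),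
      cov (constField (x p) ((trivializationAt E' (TangentSpace I' : M' → Type _)
        (x p)).continuousLinearMapAt ℝ (x p) a)) (x p) b =
      cov (constField (x p) ((trivializationAt E' (TangentSpace I' : M' → Type _)
        (x p)).continuousLinearMapAt ℝ (x p) b)) (x p) a := by
    intro a b
    have := cov.torsion_eq_zero_iff.1 hcov
      (mdifferentiableAt_constField (x p) ((trivializationAt E' (TangentSpace I' : M' → Type _)
        (x p)).continuousLinearMapAt ℝ (x p) b))
      (mdifferentiableAt_constField (x p) ((trivializationAt E' (TangentSpace I' : M' → Type _)
        (x p)).continuousLinearMapAt ℝ (x p) a))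
    rw [mlieBracket_constField, constField_self, constField_self] at this
    exact sub_eq_zero.1 this
  simp only [covAlong, add_apply, ContinuousLinearMap.comp_apply]
  rw [mvfderiv_coordsAlong_mfderiv_constField_comm hx u w]
  congr 1
  exact key _ _

end Along

end NullHyp

/-! ### Smoothness of the rigged vector field -/

namespace NullHyp
namespace RiggedNullHypersurface

section Fields

variable {n : ℕ} {M' : Type*} [TopologicalSpace M'] [ChartedSpace (EuclideanSpace ℝ (Fin (n + 1))) M']
  [IsManifold (𝓡 (n + 1)) ∞ M'] {g' : SemiRiemannianMetric (𝓡 (n + 1)) M'}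
  {M : Type*} [TopologicalSpace M] [ChartedSpace (EuclideanSpace ℝ (Fin n)) M]
  [IsManifold (𝓡 n) ∞ M] (S : RiggedNullHypersurface g' M)

lemma contMDiff_x : ContMDiff (𝓡 n) (𝓡 (n + 1)) ∞ S.x := S.isSmoothEmbedding.contMDiff

/-- In immersion charts the embedding is a linear inclusion; project back. -/
lemma exists_leftInverse (p : M) : ∃ r : M' → M, MDifferentiableAt (𝓡 (n + 1)) (𝓡 n) r (S.x p) ∧
    ∀ᶠ y in 𝓝 p, r (S.x y) = y := by
  have h : IsImmersionAt (𝓡 n) (𝓡 (n + 1)) ∞ S.x p := S.isSmoothEmbedding.isImmersion.isImmersionAt p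
  set φ := h.domChart.extend (𝓡 n) with hφ
  set ψ := h.codChart.extend (𝓡 (n + 1)) with hψ
  have hps := h.mem_domChart_source
  have hσd : MDifferentiableAt 𝓘(ℝ, EuclideanSpace ℝ (Fin n)) (𝓡 n) φ.symm (φ p) := by
    have h1 := contMDiffOn_extend_symm h.domChart_mem_maximalAtlas
    refine (h1.contMDiffAt ?_).mdifferentiableAt (by simp)
    simp only [modelWithCornersSelf_coe, image_id]
    exact h.domChart.open_target.mem_nhds (h.domChart.map_source hps)
  have hψd : MDifferentiableAt (𝓡 (n + 1)) 𝓘(ℝ, EuclideanSpace ℝ (Fin (n + 1))) ψ (S.x p) :=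
    (h.codChart.contMDiffAt_extend h.codChart_mem_maximalAtlas
      h.mem_codChart_source).mdifferentiableAt (by simp)
  let L : EuclideanSpace ℝ (Fin (n + 1)) →L[ℝ] EuclideanSpace ℝ (Fin n) :=
    (ContinuousLinearMap.fst ℝ _ _) ∘L h.equiv.symm.toContinuousLinearMap
  have hL : ∀ y ∈ h.domChart.source, L (ψ (S.x y)) = φ y := by
    intro y hy
    have hy' : y ∈ φ.source := by rw [hφ, h.domChart.extend_source]; exact hy
    have h2 := h.writtenInCharts (φ.map_source hy')
    simp only [Function.comp_apply] at h2
    rw [← hφ, ← hψ, φ.left_inv hy'] at h2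
    rw [h2]
    simp [L]
  refine ⟨φ.symm ∘ L ∘ ψ, ?_, ?_⟩
  · refine MDifferentiableAt.comp (I' := 𝓘(ℝ, EuclideanSpace ℝ (Fin n))) _ ?_ ?_
    · simp only [Function.comp_apply]
      rw [hL p hps]
      exact hσd
    · exact L.mdifferentiableAt.comp _ hψd
  · filter_upwards [h.domChart.open_source.mem_nhds hps] with y hy
    have hy' : y ∈ φ.source := by rw [hφ, h.domChart.extend_source]; exact hy
    simp only [Function.comp_apply]
    rw [hL y hy, φ.left_inv hy']

lemma contMDiffAt_dx {Y : ∀ p : M, TangentSpace (𝓡 n) p} {p : M}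
    (hY : ContMDiffAt (𝓡 n) (𝓡 n).tangent ∞ (T% Y) p) :
    ContMDiffAt (𝓡 n) (𝓡 (n + 1)).tangent ∞
      (fun y ↦ (⟨S.x y, S.dx y (Y y)⟩ : TangentBundle (𝓡 (n + 1)) M')) p :=
  (S.contMDiff_x.contMDiff_tangentMap (m := ∞) (by decide)).contMDiffAt.comp p hY

lemma contMDiffAt_N (p : M) : ContMDiffAt (𝓡 n) (𝓡 (n + 1)).tangent ∞
    (fun y ↦ (⟨S.x y, S.N (S.x y)⟩ : TangentBundle (𝓡 (n + 1)) M')) p :=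
  ContMDiffAt.comp p (S.contMDiffOn_N.contMDiffAt
    (S.isOpen_U.mem_nhds (S.range_subset (mem_range_self p)))) S.contMDiff_x.contMDiffAt

lemma mdifferentiableAt_N (p : M) :
    MDifferentiableAt (𝓡 (n + 1)) (𝓡 (n + 1)).tangent (T% S.N) (S.x p) :=
  (S.contMDiffOn_N.contMDiffAt
    (S.isOpen_U.mem_nhds (S.range_subset (mem_range_self p)))).mdifferentiableAt (by simp)

lemma contMDiffAt_g {Y Z : ∀ p : M, TangentSpace (𝓡 n) p} {p : M}
    (hY : ContMDiffAt (𝓡 n) (𝓡 n).tangent ∞ (T% Y) p)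
    (hZ : ContMDiffAt (𝓡 n) (𝓡 n).tangent ∞ (T% Z) p) :
    ContMDiffAt (𝓡 n) 𝓘(ℝ, ℝ) ∞ (fun y ↦ S.g y (Y y) (Z y)) p :=
  g'.contMDiffAt_apply (k := ⊤) (S.contMDiffAt_dx hY) (S.contMDiffAt_dx hZ)

lemma contMDiffAt_eta {Y : ∀ p : M, TangentSpace (𝓡 n) p} {p : M}
    (hY : ContMDiffAt (𝓡 n) (𝓡 n).tangent ∞ (T% Y) p) :
    ContMDiffAt (𝓡 n) 𝓘(ℝ, ℝ) ∞ (fun y ↦ S.eta y (Y y)) p :=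
  g'.contMDiffAt_apply (k := ⊤) (S.contMDiffAt_N p) (S.contMDiffAt_dx hY)

lemma mdifferentiableAt_eta {Y : ∀ p : M, TangentSpace (𝓡 n) p} {p : M}
    (hY : MDifferentiableAt (𝓡 n) (𝓡 n).tangent (T% Y) p) : MDifferentiableAt (𝓡 n) 𝓘(ℝ, ℝ) (fun y ↦ S.eta y (Y y)) p :=
  g'.mdifferentiableAt_apply ((S.contMDiffAt_N p).mdifferentiableAt (by simp))
    (S.mdifferentiableAt_dx hY)

lemma mdifferentiableAt_g {Y Z : ∀ p : M, TangentSpace (𝓡 n) p} {p : M}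
    (hY : MDifferentiableAt (𝓡 n) (𝓡 n).tangent (T% Y) p) (hZ : MDifferentiableAt (𝓡 n) (𝓡 n).tangent (T% Z) p) :
    MDifferentiableAt (𝓡 n) 𝓘(ℝ, ℝ) (fun y ↦ S.g y (Y y) (Z y)) p :=
  g'.mdifferentiableAt_apply (S.mdifferentiableAt_dx hY) (S.mdifferentiableAt_dx hZ)

lemma g_symm (p : M) (u v : TangentSpace (𝓡 n) p) : S.g p u v = S.g p v u := g'.symm _ _ _

lemma g_xi_left (p : M) (v : TangentSpace (𝓡 n) p) : S.g p (S.xi p) v = 0 := (S.xi_spec p).1 v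

lemma g_xi_right (p : M) (v : TangentSpace (𝓡 n) p) : S.g p v (S.xi p) = 0 := by
  rw [g_symm, g_xi_left]

lemma eta_xi (p : M) : S.eta p (S.xi p) = 1 := by
  rw [eta, ContinuousLinearMap.comp_apply, g'.symm]; exact (S.xi_spec p).2

/-- The nondegenerate bilinear form `g + η ⊗ η`, bundled as a bilinear map. -/
noncomputable def assocForm (p : M) :
    TangentSpace (𝓡 n) p →ₗ[ℝ] TangentSpace (𝓡 n) p →ₗ[ℝ] ℝ :=
  LinearMap.mk₂ ℝ (fun u v ↦ S.g p u v + S.eta p u * S.eta p v)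
    (fun u u' v ↦ by simp only [g, map_add, add_apply]; ring)
    (fun c u v ↦ by simp only [g, map_smul, smul_apply, smul_eq_mul]; ring)
    (fun u v v' ↦ by simp only [g, map_add]; ring)
    (fun c u v ↦ by simp only [g, map_smul, smul_eq_mul]; ring)

lemma assocForm_apply (p : M) (u v : TangentSpace (𝓡 n) p) :
    S.assocForm p u v = S.g p u v + S.eta p u * S.eta p v := rfl

lemma assocForm_nondegenerate {p : M} {u : TangentSpace (𝓡 n) p}
    (hu : ∀ v, S.assocForm p u v = 0) : u = 0 :=
  S.assocMetric_nondegenerate (α := fun _ ↦ 1) one_ne_zero fun v ↦ by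
    rw [assocMetric, one_mul, ← assocForm_apply, hu]

lemma assocForm_xi (p : M) (v : TangentSpace (𝓡 n) p) : S.assocForm p (S.xi p) v = S.eta p v := by
  rw [assocForm_apply, g_xi_left, eta_xi, zero_add, one_mul]

/-- `ξ` is the vector field dual to `η` for the nondegenerate form `g + η ⊗ η`, so its coordinates
solve a linear system with smooth invertible matrix. -/
theorem contMDiffAt_xi (p : M) : ContMDiffAt (𝓡 n) (𝓡 n).tangent ∞ (T% S.xi) p := by
  set t := trivializationAt (EuclideanSpace ℝ (Fin n)) (TangentSpace (𝓡 n) : M → Type _) p with ht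
  have hp : p ∈ t.baseSet := FiberBundle.mem_baseSet_trivializationAt' p
  let b := (EuclideanSpace.basisFun (Fin n) ℝ).toBasis
  let e : Fin n → ∀ y : M, TangentSpace (𝓡 n) y := fun i ↦ constField p (b i)
  have he : ∀ i, ContMDiffAt (𝓡 n) (𝓡 n).tangent ∞ (T% (e i)) p := fun i ↦
    contMDiffAt_constField p (b i)
  -- the Gram matrix of `g + η ⊗ η` in the frame `e`, as an endomorphism of the model space
  let A : M → EuclideanSpace ℝ (Fin n) →L[ℝ] EuclideanSpace ℝ (Fin n) := fun y ↦
    ∑ i, ∑ j, S.assocForm y (e i y) (e j y) •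
      (LinearMap.toContinuousLinearMap (b.coord i)).smulRight (b j)
  let h : M → EuclideanSpace ℝ (Fin n) := fun y ↦ ∑ j, S.eta y (e j y) • b j
  have hA : ContMDiffAt (𝓡 n)
      𝓘(ℝ, EuclideanSpace ℝ (Fin n) →L[ℝ] EuclideanSpace ℝ (Fin n)) ∞ A p :=
    ContMDiffAt.sum fun i _ ↦ ContMDiffAt.sum fun j _ ↦
      ((S.contMDiffAt_g (he i) (he j)).add
        ((S.contMDiffAt_eta (he i)).mul (S.contMDiffAt_eta (he j)))).smul contMDiffAt_const
  have hh : ContMDiffAt (𝓡 n) 𝓘(ℝ, EuclideanSpace ℝ (Fin n)) ∞ h p :=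
    ContMDiffAt.sum fun j _ ↦ (S.contMDiffAt_eta (he j)).smul contMDiffAt_const
  have hAw : ∀ y w, A y w = ∑ j, S.assocForm y (t.symmL ℝ y w) (e j y) • b j := by
    intro y w
    have hw : t.symmL ℝ y w = ∑ i, b.repr w i • e i y := by
      conv_lhs => rw [← b.sum_repr w, map_sum]
      simp only [map_smul]
      rfl
    simp only [A, sum_apply, smul_apply, ContinuousLinearMap.smulRight_apply, hw, map_sum, map_smul,
      LinearMap.sum_apply, LinearMap.smul_apply, Finset.sum_smul]
    rw [Finset.sum_comm]
    refine Finset.sum_congr rfl fun j _ ↦ Finset.sum_congr rfl fun i _ ↦ ?_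
    rw [smul_eq_mul, mul_comm, mul_smul]
    rfl
  have hinv : ∀ y ∈ t.baseSet, (A y).IsInvertible := by
    intro y hy
    have hinj : Function.Injective (A y) := by
      rw [injective_iff_map_eq_zero]
      intro w hw
      rw [hAw] at hw
      have hz : ∀ j, S.assocForm y (t.symmL ℝ y w) (e j y) = 0 := fun j ↦
        Fintype.linearIndependent_iff.1 b.linearIndependent _ hw j
      have h0 : t.symmL ℝ y w = 0 := by
        refine S.assocForm_nondegenerate fun v ↦ ?_
        have hv : v = ∑ i, b.repr (t.continuousLinearMapAt ℝ y v) i • e i y := by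
          conv_lhs => rw [← t.symmL_continuousLinearMapAt (R := ℝ) hy v,
            ← b.sum_repr (t.continuousLinearMapAt ℝ y v), map_sum]
          simp only [map_smul]
          rfl
        rw [hv, map_sum]
        refine Finset.sum_eq_zero fun i _ ↦ ?_
        rw [map_smul, hz, smul_zero]
      rw [← t.continuousLinearMapAt_symmL (R := ℝ) hy w, h0, map_zero]
    exact ⟨(LinearEquiv.ofInjectiveEndo (A y).toLinearMap hinj).toContinuousLinearEquiv, rfl⟩
  rw [contMDiffAt_section]
  have hAinv : ContMDiffAt (𝓡 n)
      𝓘(ℝ, EuclideanSpace ℝ (Fin n) →L[ℝ] EuclideanSpace ℝ (Fin n)) ∞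
      (fun y ↦ (A y).inverse) p :=
    ((hinv p hp).contDiffAt_map_inverse).contMDiffAt.comp p hA
  refine (hAinv.clm_apply hh).congr_of_eventuallyEq ?_
  filter_upwards [t.open_baseSet.mem_nhds hp] with y hy
  have h1 : A y (t.continuousLinearMapAt ℝ y (S.xi y)) = h y := by
    rw [hAw, t.symmL_continuousLinearMapAt hy]
    simp only [assocForm_xi, h]
  rw [← ht, ← h1, (hinv y hy).inverse_apply_self]
  exact (congrFun (Bundle.Trivialization.coe_linearMapAt_of_mem (R := ℝ) t hy) (S.xi y)).symm

end Fields

end RiggedNullHypersurface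
end NullHyp

/-! ### Gauss and Weingarten formulas -/

namespace NullHyp
namespace RiggedNullHypersurface

section Equations

variable {n : ℕ} {M' : Type*} [TopologicalSpace M'] [ChartedSpace (EuclideanSpace ℝ (Fin (n + 1))) M']
  [IsManifold (𝓡 (n + 1)) ∞ M'] {g' : SemiRiemannianMetric (𝓡 (n + 1)) M'}
  {M : Type*} [TopologicalSpace M] [ChartedSpace (EuclideanSpace ℝ (Fin n)) M]
  [IsManifold (𝓡 n) ∞ M] (S : RiggedNullHypersurface g' M)
  {nabla : CovariantDerivative (𝓡 (n + 1)) (EuclideanSpace ℝ (Fin (n + 1)))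
    (TangentSpace (𝓡 (n + 1)) : M' → Type _)}

lemma mdifferentiableAt_xi (p : M) :
    MDifferentiableAt (𝓡 n) (𝓡 n).tangent (T% S.xi) p :=
  (S.contMDiffAt_xi p).mdifferentiableAt (by simp)

lemma mdifferentiableAt_N_along (p : M) : MDifferentiableAt (𝓡 n) (𝓡 (n + 1)).tangent
    (fun y ↦ (⟨S.x y, S.N (S.x y)⟩ : TangentBundle (𝓡 (n + 1)) M')) p :=
  (S.contMDiffAt_N p).mdifferentiableAt (by simp)

lemma mvfderiv_along (hLC : IsLeviCivita (fun q u v ↦ g'.val q u v) nabla) {p : M}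
    {V W : ∀ p : M, TangentSpace (𝓡 (n + 1)) (S.x p)}
    (hV : MDifferentiableAt (𝓡 n) (𝓡 (n + 1)).tangent
      (fun y ↦ (⟨S.x y, V y⟩ : TangentBundle (𝓡 (n + 1)) M')) p)
    (hW : MDifferentiableAt (𝓡 n) (𝓡 (n + 1)).tangent
      (fun y ↦ (⟨S.x y, W y⟩ : TangentBundle (𝓡 (n + 1)) M')) p) (v : TangentSpace (𝓡 n) p) :
    mvfderiv (𝓡 n) (fun y ↦ g'.val (S.x y) (V y) (W y)) p v =
      g'.val (S.x p) (covAlong nabla S.x V p v) (W p) +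
        g'.val (S.x p) (V p) (covAlong nabla S.x W p v) := by
  obtain ⟨r, hr, hrx⟩ := S.exists_leftInverse p
  exact hLC.mvfderiv_along (S.contMDiff_x.mdifferentiableAt (by simp)) hr hrx hV hW v

lemma covAlong_N (p : M) (v : TangentSpace (𝓡 n) p) :
    covAlong nabla S.x (fun y ↦ S.N (S.x y)) p v = S.derivN nabla p v :=
  covAlong_comp nabla (S.contMDiff_x.mdifferentiableAt (by simp)) (S.mdifferentiableAt_N p) v

/-- The components of a vector in `TM'|_M = TM ⊕ span(N)`; that along `N` is read off by pairing
with `ξ`. -/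
lemma eq_dx_tanProj_add (p : M) (w : TangentSpace (𝓡 (n + 1)) (S.x p)) :
    w = S.dx p (S.tanProj p w) + g'.val (S.x p) w (S.dx p (S.xi p)) • S.N (S.x p) := by
  obtain ⟨⟨u, t⟩, hut⟩ := (S.decomp p).surjective w
  have h1 : S.tanProj p w = u := by
    change ((S.decomp p).symm w).1 = u
    rw [← hut, LinearEquiv.symm_apply_apply]
  have h2 : w = S.dx p u + t • S.N (S.x p) := by
    rw [← hut, ← sumMap_apply]; rfl
  have h3 : g'.val (S.x p) (S.dx p u) (S.dx p (S.xi p)) = 0 := S.g_xi_right p u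
  have h4 : g'.val (S.x p) (S.N (S.x p)) (S.dx p (S.xi p)) = 1 := S.eta_xi p
  have h5 : g'.val (S.x p) w (S.dx p (S.xi p)) = t := by
    rw [h2, map_add, map_smul, add_apply, smul_apply, h3, h4]
    simp
  rw [h1, h5, ← h2]

lemma derivN_eq (p : M) (v : TangentSpace (𝓡 n) p) : S.derivN nabla p v =
    -S.dx p (S.shapeN nabla p v) + S.tau nabla p v • S.N (S.x p) := by
  conv_lhs => rw [S.eq_dx_tanProj_add p (S.derivN nabla p v)]
  rw [shapeN, map_neg, neg_neg]
  rfl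

lemma val_N_derivN (hLC : IsLeviCivita (fun q u v ↦ g'.val q u v) nabla) (p : M)
    (v : TangentSpace (𝓡 n) p) : g'.val (S.x p) (S.N (S.x p)) (S.derivN nabla p v) = 0 := by
  have h := S.mvfderiv_along hLC (S.mdifferentiableAt_N_along p) (S.mdifferentiableAt_N_along p) v
  have h0 : (fun y ↦ g'.val (S.x y) (S.N (S.x y)) (S.N (S.x y))) = fun _ ↦ (0 : ℝ) :=
    funext S.lightlike
  rw [h0, mvfderiv_const, covAlong_N, g'.symm _ (S.derivN nabla p v)] at h
  rw [zero_apply] at h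
  linarith

lemma eta_shapeN (hLC : IsLeviCivita (fun q u v ↦ g'.val q u v) nabla) (p : M)
    (v : TangentSpace (𝓡 n) p) : S.eta p (S.shapeN nabla p v) = 0 := by
  have h := S.val_N_derivN hLC p v
  rw [derivN_eq, map_add, map_neg, map_smul, S.lightlike, smul_zero, add_zero, neg_eq_zero] at h
  exact h

lemma eta_shapeXi (p : M) (v : TangentSpace (𝓡 n) p) : S.eta p (S.shapeXi nabla p v) = 0 := by
  rw [shapeXi, P, map_neg, map_sub, map_smul, eta_xi, smul_eq_mul, mul_one, sub_self, neg_zero]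

/-- The second fundamental form `B(v, Y) = g'(∇'_v Y, ξ)` is `g(A*_ξ v, Y)`. -/
lemma val_covAlong_xi (hLC : IsLeviCivita (fun q u v ↦ g'.val q u v) nabla) {p : M}
    {Y : ∀ p : M, TangentSpace (𝓡 n) p}
    (hY : MDifferentiableAt (𝓡 n) (𝓡 n).tangent (T% Y) p) (v : TangentSpace (𝓡 n) p) :
    g'.val (S.x p) (covAlong nabla S.x (fun y ↦ S.dx y (Y y)) p v) (S.dx p (S.xi p)) =
      S.g p (S.shapeXi nabla p v) (Y p) := by
  have hξ := S.mdifferentiableAt_dx (S.mdifferentiableAt_xi p)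
  set D := covAlong nabla S.x (fun y ↦ S.dx y (S.xi y)) p v with hD
  have h1 : g'.val (S.x p) D (S.dx p (S.xi p)) = 0 := by
    have h := S.mvfderiv_along hLC hξ hξ v
    have h0 : (fun y ↦ g'.val (S.x y) (S.dx y (S.xi y)) (S.dx y (S.xi y))) = fun _ ↦ (0 : ℝ) :=
      funext fun y ↦ S.g_xi_left y _
    rw [h0, mvfderiv_const, zero_apply, ← hD, g'.symm _ _ D] at h
    linarith
  have h2 : g'.val (S.x p) (covAlong nabla S.x (fun y ↦ S.dx y (Y y)) p v) (S.dx p (S.xi p)) +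
      g'.val (S.x p) (S.dx p (Y p)) D = 0 := by
    have h := S.mvfderiv_along hLC (S.mdifferentiableAt_dx hY) hξ v
    have h0 : (fun y ↦ g'.val (S.x y) (S.dx y (Y y)) (S.dx y (S.xi y))) = fun _ ↦ (0 : ℝ) :=
      funext fun y ↦ S.g_xi_right y _
    rw [h0, mvfderiv_const, zero_apply] at h
    exact h.symm
  -- `∇'_v ξ` is tangent to `M`, by `h1`
  have h3 : D = S.dx p (S.tanProj p D) := by
    conv_lhs => rw [S.eq_dx_tanProj_add p D, h1, zero_smul, add_zero]
  have h4 : S.tanProj p D = -S.shapeXi nabla p v + S.eta p (S.tanProj p D) • S.xi p := by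
    rw [shapeXi, P, neg_neg]
    exact (sub_add_cancel _ _).symm
  have h5 : g'.val (S.x p) (S.dx p (Y p)) D = -S.g p (S.shapeXi nabla p v) (Y p) := by
    rw [h3, h4, map_add, map_neg, map_smul, map_add, map_neg, map_smul]
    have := S.g_xi_right p (Y p)
    rw [g] at this
    rw [this, g_symm, g, smul_zero, add_zero]
  linarith

lemma covAlong_dx_constField_comm (hLC : IsLeviCivita (fun q u v ↦ g'.val q u v) nabla) (p : M)
    (u w : EuclideanSpace ℝ (Fin n)) :
    covAlong nabla S.x (fun y ↦ S.dx y (constField (I' := 𝓡 n) p w y)) p (constField (I' := 𝓡 n) p u p) =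
      covAlong nabla S.x (fun y ↦ S.dx y (constField (I' := 𝓡 n) p u y)) p (constField (I' := 𝓡 n) p w p) :=
  covAlong_mfderiv_constField_comm hLC.torsion_free S.contMDiff_x u w

lemma exists_constField_eq (p : M) (v : TangentSpace (𝓡 n) p) :
    ∃ w : EuclideanSpace ℝ (Fin n), constField (I' := 𝓡 n) p w p = v :=
  ⟨_, constField_self p v⟩

/-- The second fundamental form is symmetric. -/
lemma g_shapeXi_comm (hLC : IsLeviCivita (fun q u v ↦ g'.val q u v) nabla) (p : M)
    (u w : TangentSpace (𝓡 n) p) :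
    S.g p (S.shapeXi nabla p u) w = S.g p (S.shapeXi nabla p w) u := by
  obtain ⟨a, rfl⟩ := exists_constField_eq p u
  obtain ⟨b, rfl⟩ := exists_constField_eq p w
  rw [← S.val_covAlong_xi hLC (mdifferentiableAt_constField p b),
    ← S.val_covAlong_xi hLC (mdifferentiableAt_constField p a), S.covAlong_dx_constField_comm hLC]

lemma g_shapeXi_xi (hLC : IsLeviCivita (fun q u v ↦ g'.val q u v) nabla) (p : M)
    (u : TangentSpace (𝓡 n) p) : S.g p (S.shapeXi nabla p (S.xi p)) u = 0 := by
  rw [S.g_shapeXi_comm hLC, g_xi_right]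

/-- The induced connection is torsion-free: `∇'_U (dx W) = ∇'_W (dx U)` for coordinate fields, and
`∇` is the tangential part. -/
lemma inducedConnection_torsion (hLC : IsLeviCivita (fun q u v ↦ g'.val q u v) nabla) :
    (S.inducedConnection nabla).torsion = 0 := by
  ext1 p
  ext1 u
  ext1 w
  obtain ⟨a, rfl⟩ := exists_constField_eq p u
  obtain ⟨b, rfl⟩ := exists_constField_eq p w
  rw [CovariantDerivative.torsion_apply _ (mdifferentiableAt_constField p a)
    (mdifferentiableAt_constField p b), mlieBracket_constField, sub_zero]
  exact sub_eq_zero.2 (congrArg (S.tanProj p) (S.covAlong_dx_constField_comm hLC p a b))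

/-- The Gauss formula `∇'_v Y = ∇_v Y + g(A*_ξ v, Y) N`. -/
lemma covAlong_dx_eq (hLC : IsLeviCivita (fun q u v ↦ g'.val q u v) nabla) {p : M}
    {Y : ∀ p : M, TangentSpace (𝓡 n) p}
    (hY : MDifferentiableAt (𝓡 n) (𝓡 n).tangent (T% Y) p) (v : TangentSpace (𝓡 n) p) :
    covAlong nabla S.x (fun y ↦ S.dx y (Y y)) p v =
      S.dx p (S.inducedConnection nabla Y p v) +
        S.g p (S.shapeXi nabla p v) (Y p) • S.N (S.x p) := by
  conv_lhs => rw [S.eq_dx_tanProj_add p (covAlong nabla S.x (fun y ↦ S.dx y (Y y)) p v),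
    S.val_covAlong_xi hLC hY]
  rfl

/-- The covariant derivative of the rigged metric:
`(∇_v g)(Y, Z) = B(v, Y) η(Z) + B(v, Z) η(Y)`. -/
lemma mvfderiv_g (hLC : IsLeviCivita (fun q u v ↦ g'.val q u v) nabla) {p : M}
    {Y Z : ∀ p : M, TangentSpace (𝓡 n) p}
    (hY : MDifferentiableAt (𝓡 n) (𝓡 n).tangent (T% Y) p)
    (hZ : MDifferentiableAt (𝓡 n) (𝓡 n).tangent (T% Z) p) (v : TangentSpace (𝓡 n) p) :
    mvfderiv (𝓡 n) (fun y ↦ S.g y (Y y) (Z y)) p v =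
      S.g p (S.inducedConnection nabla Y p v) (Z p) +
        S.g p (Y p) (S.inducedConnection nabla Z p v) +
      S.g p (S.shapeXi nabla p v) (Y p) * S.eta p (Z p) +
        S.g p (S.shapeXi nabla p v) (Z p) * S.eta p (Y p) := by
  have h := S.mvfderiv_along hLC (S.mdifferentiableAt_dx hY) (S.mdifferentiableAt_dx hZ) v
  rw [S.covAlong_dx_eq hLC hY, S.covAlong_dx_eq hLC hZ, map_add, map_add, add_apply, map_smul,
    map_smul, smul_apply, g'.symm _ (S.dx p (Y p)) (S.N (S.x p))] at h
  refine h.trans ?_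
  simp only [smul_eq_mul]
  change S.g p _ _ + _ * S.eta p (Z p) + (S.g p _ _ + _ * S.eta p (Y p)) = _
  ring

lemma val_derivN_dx (p : M) (v u : TangentSpace (𝓡 n) p) :
    g'.val (S.x p) (S.derivN nabla p v) (S.dx p u) =
      S.tau nabla p v * S.eta p u - S.g p (S.shapeN nabla p v) u := by
  rw [derivN_eq, map_add, map_neg, map_smul, add_apply, neg_apply, smul_apply]
  change -S.g p _ u + S.tau nabla p v * S.eta p u = _
  ring

/-- The covariant derivative of `η`: `(∇_v η)(Y) = τ(v) η(Y) - g(A_N v, Y)`. -/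
lemma mvfderiv_eta (hLC : IsLeviCivita (fun q u v ↦ g'.val q u v) nabla) {p : M}
    {Y : ∀ p : M, TangentSpace (𝓡 n) p}
    (hY : MDifferentiableAt (𝓡 n) (𝓡 n).tangent (T% Y) p) (v : TangentSpace (𝓡 n) p) :
    mvfderiv (𝓡 n) (fun y ↦ S.eta y (Y y)) p v = S.eta p (S.inducedConnection nabla Y p v) +
      S.tau nabla p v * S.eta p (Y p) - S.g p (S.shapeN nabla p v) (Y p) := by
  have h := S.mvfderiv_along hLC (S.mdifferentiableAt_N_along p) (S.mdifferentiableAt_dx hY) v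
  rw [covAlong_N, val_derivN_dx, S.covAlong_dx_eq hLC hY, map_add, map_smul, S.lightlike,
    smul_zero, add_zero] at h
  refine h.trans ?_
  change _ + S.eta p _ = _
  ring

/-- On a closed rigged null hypersurface `g'(∇'_v N, u)` is symmetric in `u` and `v`, as its
antisymmetric part is `dη`. -/
lemma IsClosed.tau_mul_eta_sub_comm (hLC : IsLeviCivita (fun q u v ↦ g'.val q u v) nabla)
    (hS : S.IsClosed) (p : M) (u v : TangentSpace (𝓡 n) p) :
    S.tau nabla p v * S.eta p u - S.g p (S.shapeN nabla p v) u =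
      S.tau nabla p u * S.eta p v - S.g p (S.shapeN nabla p u) v := by
  obtain ⟨a, rfl⟩ := exists_constField_eq p u
  obtain ⟨b, rfl⟩ := exists_constField_eq p v
  have ha := mdifferentiableAt_constField (I' := 𝓡 n) p a
  have hb := mdifferentiableAt_constField (I' := 𝓡 n) p b
  have h := hS p _ _ ha hb
  rw [S.mvfderiv_eta hLC ha, S.mvfderiv_eta hLC hb, mlieBracket_constField, map_zero] at h
  have h2 := (S.inducedConnection nabla).torsion_eq_zero_iff.1 (S.inducedConnection_torsion hLC)
    ha hb
  rw [mlieBracket_constField, sub_eq_zero] at h2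
  rw [h2] at h
  linarith

/-- If `A*_ξ = α A_N` with `α ≠ 0`, then the rotation form of a closed rigged null hypersurface
vanishes on the screen distribution. -/
lemma IsClosed.tau_eq_zero (hLC : IsLeviCivita (fun q u v ↦ g'.val q u v) nabla)
    (hS : S.IsClosed) {p : M} {a : ℝ} (ha : a ≠ 0)
    (hA : S.shapeXi nabla p (S.xi p) = a • S.shapeN nabla p (S.xi p))
    {v : TangentSpace (𝓡 n) p} (hv : S.eta p v = 0) : S.tau nabla p v = 0 := by
  have h := IsClosed.tau_mul_eta_sub_comm S hLC hS p (S.xi p) v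
  have h1 : S.g p (S.shapeN nabla p (S.xi p)) v = 0 := by
    have h2 := S.g_shapeXi_xi hLC p v
    rw [hA] at h2
    simp only [g, map_smul, smul_apply, smul_eq_mul] at h2
    exact (mul_eq_zero.1 h2).resolve_left ha
  rw [eta_xi, g_xi_right, hv, h1] at h
  linarith

/-- Tangent vectors are determined by `g` and `η`, since `g + η ⊗ η` is nondegenerate. -/
lemma eq_of_g_eq_of_eta_eq {p : M} {u w : TangentSpace (𝓡 n) p}
    (hg : ∀ v, S.g p u v = S.g p w v) (hη : S.eta p u = S.eta p w) : u = w := by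
  rw [← sub_eq_zero]
  refine S.assocForm_nondegenerate fun v ↦ ?_
  rw [map_sub, LinearMap.sub_apply, assocForm_apply, assocForm_apply, hg, hη, sub_self]

/-- As `∇` is torsion-free, the condition is `∇ g_α = 0`; evaluating `∇ g_α` on `ξ` isolates
`dα + 2 α τ` and then `A*_ξ - α A_N`. -/
theorem isLeviCivita_assocMetric_iff (hLC : IsLeviCivita (fun q u v ↦ g'.val q u v) nabla)
    {α : M → ℝ} (hα : MDifferentiable (𝓡 n) 𝓘(ℝ, ℝ) α) :
    IsLeviCivita (S.assocMetric α) (S.inducedConnection nabla) ↔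
      (∀ p v, S.shapeXi nabla p v = α p • S.shapeN nabla p v) ∧
      ∀ p v, 2 * α p * S.tau nabla p v + mvfderiv (𝓡 n) α p v = 0 := by
  have key : ∀ (p : M) (Y Z : ∀ p : M, TangentSpace (𝓡 n) p),
      MDifferentiableAt (𝓡 n) (𝓡 n).tangent (T% Y) p →
      MDifferentiableAt (𝓡 n) (𝓡 n).tangent (T% Z) p → ∀ v : TangentSpace (𝓡 n) p,
      mvfderiv (𝓡 n) (fun y ↦ S.assocMetric α y (Y y) (Z y)) p v =
        S.assocMetric α p (S.inducedConnection nabla Y p v) (Z p) +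
          S.assocMetric α p (Y p) (S.inducedConnection nabla Z p v) +
        (S.eta p (Z p) * (S.g p (S.shapeXi nabla p v) (Y p) -
            α p * S.g p (S.shapeN nabla p v) (Y p)) +
          S.eta p (Y p) * (S.g p (S.shapeXi nabla p v) (Z p) -
            α p * S.g p (S.shapeN nabla p v) (Z p)) +
          (2 * α p * S.tau nabla p v + mvfderiv (𝓡 n) α p v) *
            (S.eta p (Y p) * S.eta p (Z p))) := by
    intro p Y Z hY hZ v
    have hYη := S.mdifferentiableAt_eta hY
    have hZη := S.mdifferentiableAt_eta hZ
    have hYZ := hYη.mul hZη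
    have h1 : mvfderiv (𝓡 n) (fun y ↦ S.assocMetric α y (Y y) (Z y)) p =
        mvfderiv (𝓡 n) (fun y ↦ S.g y (Y y) (Z y)) p +
          (α p • (S.eta p (Y p) • mvfderiv (𝓡 n) (fun y ↦ S.eta y (Z y)) p +
            S.eta p (Z p) • mvfderiv (𝓡 n) (fun y ↦ S.eta y (Y y)) p) +
          (S.eta p (Y p) * S.eta p (Z p)) • mvfderiv (𝓡 n) α p) := by
      have e1 := mvfderiv_add (S.mdifferentiableAt_g hY hZ) ((hα p).mul hYZ)
      have e2 := mvfderiv_mul (hα p) hYZ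
      have e3 := mvfderiv_mul hYη hZη
      rw [e2, e3] at e1
      exact e1
    rw [h1]
    simp only [add_apply, smul_apply, smul_eq_mul]
    rw [S.mvfderiv_g hLC hY hZ, S.mvfderiv_eta hLC hY, S.mvfderiv_eta hLC hZ]
    simp only [assocMetric]
    ring
  constructor
  · intro h
    have h0 : ∀ (p : M) (v u w : TangentSpace (𝓡 n) p),
        S.eta p w * (S.g p (S.shapeXi nabla p v) u - α p * S.g p (S.shapeN nabla p v) u) +
          S.eta p u * (S.g p (S.shapeXi nabla p v) w - α p * S.g p (S.shapeN nabla p v) w) +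
          (2 * α p * S.tau nabla p v + mvfderiv (𝓡 n) α p v) * (S.eta p u * S.eta p w) = 0 := by
      intro p v u w
      obtain ⟨a, rfl⟩ := exists_constField_eq p u
      obtain ⟨b, rfl⟩ := exists_constField_eq p w
      have ha := mdifferentiableAt_constField (I' := 𝓡 n) p a
      have hb := mdifferentiableAt_constField (I' := 𝓡 n) p b
      have h1 := h.metric p _ _ ha hb v
      rw [key p _ _ ha hb v] at h1
      linarith
    -- evaluate first on `(ξ, ξ)`, then on `(u, ξ)`
    have h1 : ∀ p v, 2 * α p * S.tau nabla p v + mvfderiv (𝓡 n) α p v = 0 := by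
      intro p v
      have h2 := h0 p v (S.xi p) (S.xi p)
      simp only [g_xi_right, eta_xi] at h2
      linarith
    refine ⟨fun p v ↦ S.eq_of_g_eq_of_eta_eq (fun u ↦ ?_) ?_, h1⟩
    · have h2 := h0 p v u (S.xi p)
      rw [h1] at h2
      simp only [g_xi_right, eta_xi] at h2
      have h3 : S.g p (α p • S.shapeN nabla p v) u = α p * S.g p (S.shapeN nabla p v) u := by
        simp only [g, map_smul, smul_apply, smul_eq_mul]
      rw [h3]
      linarith
    · rw [map_smul, eta_shapeXi, S.eta_shapeN hLC, smul_zero]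
  · rintro ⟨hA, hτ⟩
    refine ⟨S.inducedConnection_torsion hLC, fun p Y Z hY hZ v ↦ ?_⟩
    have h3 : ∀ u, S.g p (S.shapeXi nabla p v) u = α p * S.g p (S.shapeN nabla p v) u := by
      intro u
      rw [hA]
      simp only [g, map_smul, smul_apply, smul_eq_mul]
    rw [key p Y Z hY hZ v, h3, h3, hτ]
    ring

end Equations

end RiggedNullHypersurface
end NullHyp

/-! ### Functions constant on the leaves of a distribution -/

namespace NullHyp

section Leaves

variable {E : Type*} [NormedAddCommGroup E] [NormedSpace ℝ E]
  {H : Type*} [TopologicalSpace H] {I : ModelWithCorners ℝ E H}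
  {M : Type*} [TopologicalSpace M] [ChartedSpace H M] [IsManifold I ∞ M]

/-- Integral curves of a `C¹` vector field are `C¹`: in a chart the derivative is continuous. -/
lemma eventually_contMDiffAt_of_isMIntegralCurveAt [I.Boundaryless] {X : ∀ p : M, TangentSpace I p}
    {γ : ℝ → M} {t₀ : ℝ} (hX : ContMDiffAt I I.tangent 1 (T% X) (γ t₀))
    (hγ : IsMIntegralCurveAt γ X t₀) :
    ∀ᶠ t in 𝓝 t₀, ContMDiffAt 𝓘(ℝ, ℝ) I 1 γ t := by
  set φ := extChartAt I (γ t₀) with hφ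
  have hc : ContMDiffAt I 𝓘(ℝ, E) 1
      (fun y ↦ (trivializationAt E (TangentSpace I : M → Type _) (γ t₀) ⟨y, X y⟩).2) (γ t₀) :=
    (contMDiffAt_section _).1 hX
  have hc' : ∀ᶠ y in 𝓝 (γ t₀), ContinuousAt
      (fun y ↦ (trivializationAt E (TangentSpace I : M → Type _) (γ t₀) ⟨y, X y⟩).2) y := by
    have h1 := (contMDiffAt_iff_contMDiffAt_nhds (by simp)).1 hc
    filter_upwards [h1] with y hy using hy.continuousAt
  have hder : ∀ᶠ t in 𝓝 t₀, HasDerivAt (φ ∘ γ)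
      (trivializationAt E (TangentSpace I : M → Type _) (γ t₀) ⟨γ t, X (γ t)⟩).2 t :=
    hγ.eventually_hasDerivAt
  have hcont : ∀ᶠ t in 𝓝 t₀, ContinuousAt γ t := by
    filter_upwards [hγ] with t ht using ht.continuousAt
  have hF : ∀ᶠ t in 𝓝 t₀, ContinuousAt
      (fun t ↦ (trivializationAt E (TangentSpace I : M → Type _) (γ t₀) ⟨γ t, X (γ t)⟩).2) t := by
    filter_upwards [hcont, hγ.continuousAt.eventually hc'] with t h1 h2
    exact ContinuousAt.comp (f := γ) h2 h1
  have hsrc : ∀ᶠ t in 𝓝 t₀, γ t ∈ φ.source :=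
    hγ.continuousAt.preimage_mem_nhds (extChartAt_source_mem_nhds (γ t₀))
  obtain ⟨u, hu, huo, ht₀⟩ := eventually_nhds_iff.1 (hder.and (hF.and hsrc))
  have hf : ContDiffOn ℝ 1 (φ ∘ γ) u := by
    have : ContDiffOn ℝ (0 + 1) (φ ∘ γ) u := by
      rw [contDiffOn_succ_iff_deriv_of_isOpen huo]
      refine ⟨fun t ht ↦ (hu t ht).1.differentiableAt.differentiableWithinAt, by simp, ?_⟩
      rw [contDiffOn_zero]
      refine ContinuousOn.congr (fun t ht ↦ (hu t ht).2.1.continuousWithinAt)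
        fun t ht ↦ (hu t ht).1.deriv
    simpa using this
  filter_upwards [huo.mem_nhds ht₀] with t ht
  have h1 : ContMDiffAt 𝓘(ℝ, ℝ) 𝓘(ℝ, E) 1 (φ ∘ γ) t :=
    (hf.contDiffAt (huo.mem_nhds ht)).contMDiffAt
  have h2 : ContMDiffAt 𝓘(ℝ, E) I 1 φ.symm ((φ ∘ γ) t) :=
    (contMDiffOn_extChartAt_symm (γ t₀)).contMDiffAt
      ((isOpen_extChartAt_target (γ t₀)).mem_nhds (φ.map_source (hu t ht).2.2))
  refine (h2.comp t h1).congr_of_eventuallyEq ?_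
  filter_upwards [huo.mem_nhds ht] with s hs
  exact (φ.left_inv (hu s hs).2.2).symm

/-- If `X` is a field in `D` near `p`, its integral curve through `p` stays in the leaf of `p`, so
`dα(X) = 0` for every function `α` constant on that leaf. -/
lemma mvfderiv_eq_zero_of_eqOn_leaf [CompleteSpace E] [I.Boundaryless]
    {D : ∀ p : M, Submodule ℝ (TangentSpace I p)} {X : ∀ p : M, TangentSpace I p} {p : M}
    (hX : ContMDiffAt I I.tangent 1 (T% X) p) (hXD : ∀ᶠ y in 𝓝 p, X y ∈ D y) {α : M → ℝ}
    (hα : MDifferentiableAt I 𝓘(ℝ, ℝ) α p) (hconst : ∀ q ∈ leaf D p, α q = α p) :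
    mvfderiv I α p (X p) = 0 := by
  obtain ⟨γ, rfl, hγ⟩ := exists_isMIntegralCurveAt_of_contMDiffAt_boundaryless 0 hX
  obtain ⟨ε, hε, h⟩ := Metric.eventually_nhds_iff.1
    ((hγ.continuousAt.eventually hXD).and (hγ.and (eventually_contMDiffAt_of_isMIntegralCurveAt hX hγ)))
  have hleaf : ∀ s : ℝ, dist s 0 < ε → γ s ∈ leaf D (γ 0) := by
    intro s hs
    rw [Real.dist_eq, sub_zero] at hs
    -- the curves of `leaf` are defined on all of `ℝ`: reparametrize the local integral curve by
    -- `s sin(π t / 2)`, which is `0` at `t = 0`, `s` at `t = 1`, and never exceeds `|s|`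
    have hlt : ∀ t : ℝ, dist (s * Real.sin (Real.pi / 2 * t)) 0 < ε := by
      intro t
      rw [Real.dist_eq, sub_zero, abs_mul]
      exact lt_of_le_of_lt (mul_le_of_le_one_right (abs_nonneg s) (Real.abs_sin_le_one _)) hs
    have hσ : ∀ t, HasDerivAt (fun t ↦ s * Real.sin (Real.pi / 2 * t))
        (s * (Real.cos (Real.pi / 2 * t) * (Real.pi / 2))) t := fun t ↦
      ((((hasDerivAt_id t).const_mul (Real.pi / 2)).sin).const_mul s).congr_deriv (by simp)
    refine Relation.ReflTransGen.single
      ⟨fun t ↦ γ (s * Real.sin (Real.pi / 2 * t)), ?_, by simp, by simp, fun t _ ↦ ?_⟩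
    · intro t
      have hsm : ContDiff ℝ 1 (fun t : ℝ ↦ s * Real.sin (Real.pi / 2 * t)) := by fun_prop
      exact (h (hlt t)).2.2.comp t hsm.contMDiff.contMDiffAt
    · have h1 := (h (hlt t)).2.1.comp t (hσ t).hasFDerivAt.hasMFDerivAt
      have h2 := h1.mfderiv
      change mfderiv 𝓘(ℝ, ℝ) I (γ ∘ fun t ↦ s * Real.sin (Real.pi / 2 * t)) t (1 : ℝ) ∈ _
      rw [h2]
      have h3 := (D _).smul_mem (s * (Real.cos (Real.pi / 2 * t) * (Real.pi / 2))) (h (hlt t)).1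
      rw [← one_smul ℝ (s * (Real.cos (Real.pi / 2 * t) * (Real.pi / 2)))] at h3
      exact h3
  have hαγ : α ∘ γ =ᶠ[𝓝 0] fun _ ↦ α (γ 0) := by
    filter_upwards [Metric.ball_mem_nhds (0 : ℝ) hε] with s hs
    exact hconst _ (hleaf s hs)
  have h1 := (hα.hasMFDerivAt.comp (0 : ℝ) hγ.hasMFDerivAt).mfderiv
  rw [hαγ.mfderiv_eq, mfderiv_const] at h1
  have h2 := congrArg (fun A ↦ A (1 : ℝ)) h1
  have h3 : mfderiv I 𝓘(ℝ, ℝ) α (γ 0) ((1 : ℝ) • X (γ 0)) = 0 := h2.symm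
  rw [one_smul] at h3
  exact h3

end Leaves

end NullHyp

/-! ### The screen distribution -/

namespace NullHyp
namespace RiggedNullHypersurface

section Screen

variable {n : ℕ} {M' : Type*} [TopologicalSpace M'] [ChartedSpace (EuclideanSpace ℝ (Fin (n + 1))) M']
  [IsManifold (𝓡 (n + 1)) ∞ M'] {g' : SemiRiemannianMetric (𝓡 (n + 1)) M'}
  {M : Type*} [TopologicalSpace M] [ChartedSpace (EuclideanSpace ℝ (Fin n)) M]
  [IsManifold (𝓡 n) ∞ M] (S : RiggedNullHypersurface g' M)

lemma exists_screen_field {p : M} {v : TangentSpace (𝓡 n) p} (hv : S.eta p v = 0) :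
    ∃ X : ∀ p : M, TangentSpace (𝓡 n) p, ContMDiffAt (𝓡 n) (𝓡 n).tangent ∞ (T% X) p ∧
      (∀ y, X y ∈ S.screen y) ∧ X p = v := by
  obtain ⟨w, hw⟩ := exists_constField_eq p v
  have hc := contMDiffAt_constField (I := 𝓡 n) p w
  refine ⟨fun y ↦ S.P y (constField p w y), ?_, fun y ↦ ?_, ?_⟩
  · exact hc.sub_section ((S.contMDiffAt_eta hc).smul_section (S.contMDiffAt_xi p))
  · change S.eta y (S.P y _) = 0
    rw [P, map_sub, map_smul, eta_xi, smul_eq_mul, mul_one, sub_self]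
  · simp only [P, hw, hv, zero_smul, sub_zero]

lemma mvfderiv_eq_zero_of_eqOn_leaf_screen {α : M → ℝ}
    (hα : MDifferentiable (𝓡 n) 𝓘(ℝ, ℝ) α)
    (hconst : ∀ p, ∀ q ∈ leaf S.screen p, α q = α p) {p : M} {v : TangentSpace (𝓡 n) p}
    (hv : S.eta p v = 0) : mvfderiv (𝓡 n) α p v = 0 := by
  obtain ⟨X, hX, hXs, rfl⟩ := S.exists_screen_field hv
  exact mvfderiv_eq_zero_of_eqOn_leaf (hX.of_le (by simp)) (.of_forall hXs) (hα p) (hconst p)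

end Screen

end RiggedNullHypersurface
end NullHyp

/-! ### The Levi-Civita connection of the associated metrics -/

theorem mainTheorem1 {n : ℕ}
    {M' : Type*} [TopologicalSpace M'] [ChartedSpace (EuclideanSpace ℝ (Fin (n + 1))) M']
    [IsManifold (𝓡 (n + 1)) ∞ M'] [T2Space M'] [SecondCountableTopology M'] [ConnectedSpace M']
    {M : Type*} [TopologicalSpace M] [ChartedSpace (EuclideanSpace ℝ (Fin n)) M]
    [IsManifold (𝓡 n) ∞ M] [T2Space M] [SecondCountableTopology M] [ConnectedSpace M]
    (g' : NullHyp.SemiRiemannianMetric (𝓡 (n + 1)) M')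
    (nabla' : CovariantDerivative (𝓡 (n + 1)) (EuclideanSpace ℝ (Fin (n + 1)))
      (TangentSpace (𝓡 (n + 1)) : M' → Type _))
    (hnabla' : NullHyp.IsLeviCivita (fun q u v ↦ g'.val q u v) nabla')
    (S : NullHyp.RiggedNullHypersurface g' M) (hclosed : S.IsClosed) :
    (∀ α : M → ℝ, ContMDiff (𝓡 n) 𝓘(ℝ, ℝ) ∞ α → (∀ p, α p ≠ 0) →
      (∀ p, ∀ q ∈ NullHyp.leaf S.screen p, α q = α p) →
      (NullHyp.IsLeviCivita (S.assocMetric α) (S.inducedConnection nabla') ↔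
        (∀ p v, S.shapeXi nabla' p v = α p • S.shapeN nabla' p v) ∧
        ∀ p, 2 * α p * S.tau nabla' p (S.xi p) + mvfderiv (𝓡 n) α p (S.xi p) = 0)) ∧
    (∀ α : ℝ, α ≠ 0 →
      (NullHyp.IsLeviCivita (S.assocMetric fun _ ↦ α) (S.inducedConnection nabla') ↔
        (∀ p v, S.shapeXi nabla' p v = α • S.shapeN nabla' p v) ∧
        ∀ p v, S.tau nabla' p v = 0)) := by
  refine ⟨fun α hα hα0 hleaf ↦ ?_, fun a ha ↦ ?_⟩
  · have hαd : MDifferentiable (𝓡 n) 𝓘(ℝ, ℝ) α := hα.mdifferentiable (by simp)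
    rw [S.isLeviCivita_assocMetric_iff hnabla' hαd]
    refine and_congr_right fun hA ↦ ⟨fun h p ↦ h p _, fun h p v ↦ ?_⟩
    -- only the `ξ`-component of `v` contributes to `2 α τ(v) + dα(v)`
    have hη : S.eta p (v - S.eta p v • S.xi p) = 0 := by
      rw [map_sub, map_smul, S.eta_xi, smul_eq_mul, mul_one, sub_self]
    have hτ := NullHyp.RiggedNullHypersurface.IsClosed.tau_eq_zero S hnabla' hclosed (hα0 p)
      (hA p (S.xi p)) hη
    have hd := S.mvfderiv_eq_zero_of_eqOn_leaf_screen hαd hleaf hη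
    rw [map_sub, map_smul, sub_eq_zero] at hd
    have hτ' : S.tau nabla' p v = S.eta p v * S.tau nabla' p (S.xi p) := by
      simp only [NullHyp.RiggedNullHypersurface.tau, NullHyp.RiggedNullHypersurface.derivN, map_sub,
        map_smul, sub_apply, smul_apply, smul_eq_mul, sub_eq_zero] at hτ ⊢
      exact hτ
    rw [hτ', hd, smul_eq_mul]
    linear_combination S.eta p v * h p
  · rw [S.isLeviCivita_assocMetric_iff hnabla' (fun _ ↦ mdifferentiableAt_const)]
    refine and_congr_right fun _ ↦ forall₂_congr fun p v ↦ ?_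
    rw [mvfderiv_const, zero_apply, add_zero]
    simp [ha]
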